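/- Let $\tau$ be a finite relational signature and $T$ a first-order $\tau$-theory. An atomic $\tau$-formula is $R(x_1,\dots,x_k)$ with $R\in\tau$, or $x=y$, or $\bot$. $\mathrm{CSP}(T)$ is the problem of deciding whether a given conjunction of atomic $\tau$-formulas is satisfiable in some model of $T$. A sampling of $T$ is a sequence $(L_n)_{n\in\mathbb N}$ of finite sets of finite $\tau$-structures such that for every $n$ and every conjunction $\phi$ of atomic $\tau$-formulas with at most $n$ variables, $\phi$ is satisfiable in some model of $T$ if and only if $\phi$ is satisfiable in some $\mathfrak B\in L_n$. It is computable in polynomial time if some algorithm computes $L_n$ from $n$ in time polynomial in $n$. An operation $f\colon A^k\to A$ is a polymorphism of a $\tau$-structure $\mathfrak A$ if it is a homomorphism $\mathfrak A^k\to\mathfrak A$, and it is totally symmetric if $f(x_1,\dots,x_k)=f(y_1,\dots,y_k)$ whenever $\{x_1,\dots,x_k\}=\{y_1,\dots,y_k\}$. **Lemma.** Let $(L_n)_{n\in\mathbb N}$ be a sampling of $T$ that is computable in polynomial time. Suppose that for all $n$ and all $\mathfrak B\in L_n$ there are a model $\mathfrak A$ of $T$ and a homomorphism $h\colon\mathfrak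 B\to\mathfrak A$ such that the substructure $h(\mathfrak B)$ of $\mathfrak A$ induced on the image of $h$ has totally symmetric polymorphisms of all arities $k\ge 1$. Then $\mathrm{CSP}(T)$ is decidable in polynomial time. Moreover, it is decided by arc-consistency on the samples: a conjunction $\phi$ of atomic $\tau$-formulas with $n$ variables is satisfiable in some model of $T$ if and only if the arc-consistency procedure accepts $(\mathfrak B,\phi)$ for some $\mathfrak B\in L_n$. Here the arc-consistency procedure on $(\mathfrak B,\phi)$ starts with the list $D(x)=B$ for every variable $x$ and repeatedly removes from $D(x)$ those values $a$ for which some conjunct of $\phi$ containing $x$ has no satisfying assignment over $\mathfrak B$ that maps $x$ to $a$ and every variable $y$ of the conjunct into $D(y)$. When no list changes any more, it accepts if no list is empty and every conjunct has a satisfying assignment with values in the lists. -/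

import Mathlib

universe w

open FirstOrder

namespace SamplingCSP

open FirstOrder.Language FirstOrder.Language.Structure

/-! ### Atomic formulas, their conjunctions, and the CSP of a theory

Throughout, `L` is a relational signature, so the only terms are variables. -/

/-- Atomic formulas over the variables `V`: `R(x₁, …, x_k)`, `x = y`, and `⊥`. -/
inductive Atom (L : FirstOrder.Language.{0, 0}) (V : Type) : Type
  | rel {k : ℕ} (R : L.Relations k) (x : Fin k → V) : Atom L V
  | eq (x y : V) : Atom L V
  | bot : Atom L V

/-- The atomic formula holds in the structure `M` under the assignment `s`. -/
def Atom.Holds {L : FirstOrder.Language.{0, 0}} {V : Type} {M : Type*} [L.Structure M] (s : V → M) :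
    Atom L V → Prop
  | .rel R x => RelMap R (fun i => s (x i))
  | .eq x y => s x = s y
  | .bot => False

/-- The variables that occur in an atomic formula. -/
def Atom.vars {L : FirstOrder.Language.{0, 0}} {V : Type} : Atom L V → Set V
  | .rel _ x => Set.range x
  | .eq x y => {x, y}
  | .bot => ∅

/-- A conjunction of atomic formulas over the variables `x₀, …, x_{n-1}`, as the list of its
conjuncts. -/
abbrev Conj (L : FirstOrder.Language.{0, 0}) (n : ℕ) : Type := List (Atom L (Fin n))

/-- The conjunction `φ` is satisfiable in the structure `M`. -/
def SatIn {L : FirstOrder.Language.{0, 0}} {n : ℕ} (φ : Conj L n) (M : Type*) [L.Structure M] : Prop :=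
  ∃ s : Fin n → M, ∀ a ∈ φ, a.Holds s

/-- The conjunction `φ` is satisfiable in some model of the theory `T`
(models may have an empty domain). -/
def SatModulo {L : FirstOrder.Language.{0, 0}} (T : L.Theory) {n : ℕ} (φ : Conj L n) : Prop :=
  ∃ (M : Type w) (_ : L.Structure M), M ⊨ T ∧ SatIn φ M

/-- The instances of the CSP: a number `n` of variables and a conjunction of atomic formulas over
these variables. -/
abbrev Instance (L : FirstOrder.Language.{0, 0}) : Type := Σ n : ℕ, Conj L n

/-! ### Samplings -/

/-- The finite structures, on the domains `{0, …, m-1}`. -/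
abbrev FinStr (L : FirstOrder.Language.{0, 0}) : Type := Σ m : ℕ, L.Structure (Fin m)

/-- The domain of a finite structure. -/
abbrev FinStr.Dom {L : FirstOrder.Language.{0, 0}} (B : FinStr L) : Type := Fin B.1

instance {L : FirstOrder.Language.{0, 0}} (B : FinStr L) : L.Structure B.Dom := B.2

/-- `(S n)` is a sampling for `T`: each `S n` is a finite set of finite structures, and a
conjunction of atomic formulas with at most `n` variables is satisfiable in some model of `T` iff it
is satisfiable in some member of `S n`. -/
def IsSampling {L : FirstOrder.Language.{0, 0}} (T : L.Theory) (S : ℕ → Set (FinStr L)) : Prop :=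
  ∀ n : ℕ, (S n).Finite ∧
    ∀ m ≤ n, ∀ φ : Conj L m, SatModulo.{w} T φ ↔ ∃ B ∈ S n, SatIn φ B.Dom

/-! ### Encoding of instances and of finite structures as strings -/

/-- The alphabet: one letter per relation symbol of `L`, and six further letters. -/
inductive Letter (L : FirstOrder.Language.{0, 0}) : Type
  | sym (R : Σ k : ℕ, L.Relations k)
  | eq
  | bot
  | tick
  | sep
  | struct

/-- A number in unary, with an end marker. -/
def encodeNum {L : FirstOrder.Language.{0, 0}} (i : ℕ) : List (Letter L) :=
  List.replicate i Letter.tick ++ [Letter.sep]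

/-- A relation symbol, followed by its arguments in unary. -/
def encodeRel {L : FirstOrder.Language.{0, 0}} {n k : ℕ} (R : L.Relations k) (x : Fin k → Fin n) :
    List (Letter L) :=
  Letter.sym ⟨k, R⟩ :: (List.ofFn x).flatMap fun v => encodeNum (v : ℕ)

/-- The encoding of an atomic formula. -/
def encodeAtom {L : FirstOrder.Language.{0, 0}} {n : ℕ} : Atom L (Fin n) → List (Letter L)
  | .rel R x => encodeRel R x
  | .eq x y => Letter.eq :: (encodeNum (x : ℕ) ++ encodeNum (y : ℕ))
  | .bot => [Letter.bot]

/-- The encoding of a CSP instance: the number of variables in unary, then the conjuncts. -/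
def encodeInstance {L : FirstOrder.Language.{0, 0}} (φ : Instance L) : List (Letter L) :=
  encodeNum φ.1 ++ φ.2.flatMap encodeAtom

/-- A finite structure given explicitly: the size of its domain `{0, …, size-1}` and a list of all
pairs of a relation symbol and a tuple in the corresponding relation. -/
structure StrCode (L : FirstOrder.Language.{0, 0}) : Type where
  size : ℕ
  facts : List (Σ k : ℕ, L.Relations k × (Fin k → Fin size))

/-- The finite structure that is given by a code. -/
def StrCode.toFinStr {L : FirstOrder.Language.{0, 0}} [L.IsRelational] (c : StrCode L) : FinStr L :=
  ⟨c.size,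
    { funMap := fun f => isEmptyElim f
      RelMap := fun {k} R t => (⟨k, R, t⟩ : Σ k : ℕ, L.Relations k × (Fin k → Fin c.size)) ∈ c.facts }⟩

/-- The string of a structure: a start marker, the size in unary, and the facts. -/
def encodeStr {L : FirstOrder.Language.{0, 0}} (c : StrCode L) : List (Letter L) :=
  Letter.struct :: (encodeNum c.size ++ c.facts.flatMap fun f => encodeRel f.2.1 f.2.2)

/-- The string of a list of structures. -/
def encodeStrList {L : FirstOrder.Language.{0, 0}} (l : List (StrCode L)) : List (Letter L) :=
  l.flatMap encodeStr

/-! ### Polynomial time, on multi-stack Turing machines -/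

/-- `(S n)` is computable in polynomial time: some Turing machine computes from `n` (in unary) a
list of the structures in `S n`, in time polynomial in `n`. -/
def PolyTimeComputable {L : FirstOrder.Language.{0, 0}} [L.IsRelational] (S : ℕ → Set (FinStr L)) : Prop :=
  ∃ f : ℕ → List (StrCode L),
    (∀ n, S n = {B | ∃ c ∈ f n, c.toFinStr = B}) ∧
    Nonempty (Turing.TM2ComputableInPolyTime Computability.unaryEncodeNat encodeStrList f)

open Classical in
/-- `CSP(T)` is polynomial-time tractable: some Turing machine decides in time polynomial in the
length of the input whether a given instance is satisfiable in some model of `T`. -/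
def CSPPolyTime {L : FirstOrder.Language.{0, 0}} (T : L.Theory) : Prop :=
  Nonempty (Turing.TM2ComputableInPolyTime encodeInstance Computability.encodeBool
    (fun φ : Instance L => decide (SatModulo.{w} T φ.2)))

/-! ### Totally symmetric polymorphisms -/

/-- `f` is a polymorphism of the relational structure `A`. -/
def IsPolymorphism (L : FirstOrder.Language.{0, 0}) {A : Type*} [L.Structure A] {k : ℕ}
    (f : (Fin k → A) → A) : Prop :=
  ∀ (r : ℕ) (R : L.Relations r) (t : Fin k → Fin r → A),
    (∀ j, RelMap R (t j)) → RelMap R (fun i => f (fun j => t j i))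

/-- `f x = f y` whenever the tuples `x` and `y` have the same set of entries. -/
def IsTotallySymmetric {A : Type*} {k : ℕ} (f : (Fin k → A) → A) : Prop :=
  ∀ x y : Fin k → A, Set.range x = Set.range y → f x = f y

/-- `A` has totally symmetric polymorphisms of all arities `k ≥ 1`. -/
def HasTSPolymorphisms (L : FirstOrder.Language.{0, 0}) (A : Type*) [L.Structure A] : Prop :=
  ∀ k : ℕ, 1 ≤ k → ∃ f : (Fin k → A) → A, IsPolymorphism L f ∧ IsTotallySymmetric f

/-! ### The arc-consistency procedure -/

/-- The conjunct `c` has a satisfying assignment that takes its values in the lists `D`. -/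
def Supports {L : FirstOrder.Language.{0, 0}} {V : Type} {M : Type*} [L.Structure M] (D : V → Set M)
    (c : Atom L V) (s : V → M) : Prop :=
  (∀ y ∈ c.vars, s y ∈ D y) ∧ c.Holds s

/-- One round of the procedure: from the list of each variable `x`, remove the values that some
conjunct containing `x` does not support. -/
def acStep {L : FirstOrder.Language.{0, 0}} {n : ℕ} (φ : Conj L n) {M : Type*} [L.Structure M]
    (D : Fin n → Set M) : Fin n → Set M :=
  fun x => {a | a ∈ D x ∧ ∀ c ∈ φ, x ∈ c.vars → ∃ s : Fin n → M, s x = a ∧ Supports D c s}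

/-- The final lists: start with full lists and repeat the rounds (over a finite structure the lists,
which only shrink, become stationary after finitely many rounds). -/
def acLists {L : FirstOrder.Language.{0, 0}} {n : ℕ} (φ : Conj L n) (M : Type*) [L.Structure M] :
    Fin n → Set M :=
  fun x => {a | ∀ j : ℕ, a ∈ (acStep φ)^[j] (fun _ => Set.univ) x}

/-- The procedure answers "satisfiable": no final list is empty and no conjunct is violated by all
choices from the final lists. (The second condition matters for conjuncts without variables only.) -/
def ACAccepts {L : FirstOrder.Language.{0, 0}} {n : ℕ} (φ : Conj L n) (M : Type*) [L.Structure M] : Prop :=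
  (∀ x, (acLists φ M x).Nonempty) ∧ ∀ c ∈ φ, ∃ s : Fin n → M, Supports (acLists φ M) c s

end SamplingCSP

/-! Correctness. The values of a solution in a sample support each other, so arc-consistency never
removes them; by the sampling property, a satisfiable conjunction is accepted on some sample
(`acAccepts_of_satIn`). Conversely, suppose that the procedure accepts on a sample `B` with final
lists `E x`, and let `h : B → A` be the homomorphism into a model. Take a totally symmetric
polymorphism `f` of the image of `h` whose arity suffices to enumerate, with repetitions, every list
and every set of assignments. Map `x` to the value of `f` on the `h`-images of `E x`. For a
conjunct, enumerate its supporting assignments `t j`. By arc-consistency the values `t j x` run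
through exactly `E x`, so by total symmetry applying `f` to them gives the value chosen for `x`;
since `f` preserves the relations, the conjunct holds (`satIn_of_acAccepts`). This solution lies in
a model, so the converse does not need the sampling property.

Running time. Polynomial time refers to multi-stack Turing machines, so a machine has to be built.
Programs are composed from fragments with explicit step bounds. The data are binary trees in prefix
code, which is self-delimiting: a program can treat the uppermost tree of a stack and leave
everything below untouched. The functions computed in this way (`PolyTime`) are closed under
composition, pairing, case distinction, and folds whose accumulators stay polynomially bounded
(`PolyTime.foldl`). This suffices for parsing and for arc-consistency, where the number of rounds is
at most the number of pairs of a variable and a value: a round that changes something removes a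
pair.

The final machine (`cspPolyTime`) reads the instance, passes its number `n` of variables to the
machine for the sampling, reads the structures and runs `decideOn`. Since `n` is written in unary,
it is at most the input length; and a machine cannot output more than it has time to push. Hence all
sizes and times are polynomial. -/

/-! ### Composing the programs of multi-stack machines -/

namespace StackProgram

open Turing.TM2

section Code

variable {K : Type} [DecidableEq K] {Γ : K → Type} {σ Λ Λ' : Type}

/-- The program `m` leads from the configuration `c` to the configuration `c'` in at most `n`
steps. -/
inductive ReachesIn (m : Λ → Stmt Γ Λ σ) : ℕ → Cfg Γ Λ σ → Cfg Γ Λ σ → Prop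
  | refl (n : ℕ) (c : Cfg Γ Λ σ) : ReachesIn m n c c
  | head {n : ℕ} {c c₁ c₂ : Cfg Γ Λ σ} :
      step m c = some c₁ → ReachesIn m n c₁ c₂ → ReachesIn m (n + 1) c c₂

theorem ReachesIn.mono {m : Λ → Stmt Γ Λ σ} {n n' : ℕ} {c c' : Cfg Γ Λ σ}
    (h : ReachesIn m n c c') (hn : n ≤ n') : ReachesIn m n' c c' := by
  induction h generalizing n' with
  | refl n c => exact .refl _ _
  | head hs _ ih =>
    obtain ⟨k, rfl⟩ := Nat.exists_eq_add_of_le' hn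
    exact .head (n := k + _) hs (ih (Nat.le_add_left _ _))

theorem ReachesIn.trans {m : Λ → Stmt Γ Λ σ} {n n' : ℕ} {c c' c'' : Cfg Γ Λ σ}
    (h : ReachesIn m n c c') (h' : ReachesIn m n' c' c'') : ReachesIn m (n + n') c c'' := by
  induction h with
  | refl n c => exact h'.mono (Nat.le_add_left _ _)
  | @head n c c₁ c₂ hs _ ih =>
    rw [Nat.add_right_comm]
    exact .head hs (ih h')

/-- Replace the labels of a statement along `g`, and its exits by the statement `h`. -/
def graft (g : Λ → Λ') (h : Stmt Γ Λ' σ) : Stmt Γ Λ σ → Stmt Γ Λ' σ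
  | .push k f q => .push k f (graft g h q)
  | .peek k f q => .peek k f (graft g h q)
  | .pop k f q => .pop k f (graft g h q)
  | .load f q => .load f (graft g h q)
  | .branch f q₁ q₂ => .branch f (graft g h q₁) (graft g h q₂)
  | .goto f => .goto fun v => g (f v)
  | .halt => h

/-- The effect of `graft` on configurations. -/
def graftCfg (g : Λ → Λ') (h : Stmt Γ Λ' σ) : Cfg Γ Λ σ → Cfg Γ Λ' σ
  | ⟨some l, v, S⟩ => ⟨some (g l), v, S⟩
  | ⟨none, v, S⟩ => stepAux h v S

/-- Jumps and halts are the only leaves of a statement. The exit statement `h` is executed within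
the step that would have halted, which is why `graftCfg` already applies `h` to a halted
configuration. -/
theorem stepAux_graft (g : Λ → Λ') (h : Stmt Γ Λ' σ) (q : Stmt Γ Λ σ) (v : σ)
    (S : ∀ k, List (Γ k)) : stepAux (graft g h q) v S = graftCfg g h (stepAux q v S) := by
  induction q generalizing v S with
  | branch f q₁ q₂ h₁ h₂ =>
    simp only [graft, stepAux]
    cases f v <;> simp [h₁, h₂]
  | _ => simp_all [graft, graftCfg]

/-- Because leaving a program costs no extra step, the step bound is unchanged, and bounds simply
add up under sequential composition. -/
theorem ReachesIn.graft {m : Λ → Stmt Γ Λ σ} {m' : Λ' → Stmt Γ Λ' σ} {g : Λ → Λ'}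
    {h : Stmt Γ Λ' σ} (hm : ∀ l, m' (g l) = graft g h (m l)) {n : ℕ} {c c' : Cfg Γ Λ σ}
    (hc : ReachesIn m n c c') : ReachesIn m' n (graftCfg g h c) (graftCfg g h c') := by
  induction hc with
  | refl n c => exact .refl _ _
  | @head n c c₁ c₂ hs _ ih =>
    obtain ⟨_ | l, v, S⟩ := c
    · simp at hs
    · refine .head ?_ ih
      simp only [step, Option.some.injEq] at hs
      simp [graftCfg, hm, stepAux_graft, hs]

end Code

/-- A program with an entry point; its exit is the halting state. -/
structure Frag {K : Type} (Γ : K → Type) (σ : Type) where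
  Label : Type
  [fintype : Fintype Label]
  entry : Label
  code : Label → Stmt Γ Label σ

attribute [instance] Frag.fintype

namespace Frag

variable {K : Type} [DecidableEq K] {Γ : K → Type} {σ : Type}

/-- Started with the state `v` and the stacks `S`, the program halts after at most `n` steps with
the state `v'` and the stacks `S'`. -/
def Runs (F : Frag Γ σ) (v : σ) (S : ∀ k, List (Γ k)) (v' : σ) (S' : ∀ k, List (Γ k)) (n : ℕ) :
    Prop :=
  ReachesIn F.code n ⟨some F.entry, v, S⟩ ⟨none, v', S'⟩

theorem Runs.mono {F : Frag Γ σ} {v v' : σ} {S S' : ∀ k, List (Γ k)} {n n' : ℕ}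
    (h : F.Runs v S v' S' n) (hn : n ≤ n') : F.Runs v S v' S' n' :=
  ReachesIn.mono h hn

/-- A single statement that may be repeated. -/
def loop (q : Stmt Γ Unit σ) : Frag Γ σ where
  Label := Unit
  entry := ()
  code := fun _ => q

theorem loop_exit {q : Stmt Γ Unit σ} {v v' : σ} {S S' : ∀ k, List (Γ k)}
    (h : stepAux q v S = ⟨none, v', S'⟩) : (loop q).Runs v S v' S' 1 :=
  .head (by simp [loop, h]) (.refl 0 _)

theorem loop_next {q : Stmt Γ Unit σ} {v v₁ v' : σ} {S S₁ S' : ∀ k, List (Γ k)} {n : ℕ}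
    (h : stepAux q v S = ⟨some (), v₁, S₁⟩) (h' : (loop q).Runs v₁ S₁ v' S' n) :
    (loop q).Runs v S v' S' (n + 1) :=
  .head (by simp [loop, h]) h'

/-- Run one program after the other. -/
def seq (F G : Frag Γ σ) : Frag Γ σ where
  Label := F.Label ⊕ G.Label
  entry := .inl F.entry
  code
    | .inl l => graft .inl (.goto fun _ => .inr G.entry) (F.code l)
    | .inr l => graft .inr .halt (G.code l)

theorem seq_runs {F G : Frag Γ σ} {v v₁ v' : σ} {S S₁ S' : ∀ k, List (Γ k)} {n n' : ℕ}
    (h : F.Runs v S v₁ S₁ n) (h' : G.Runs v₁ S₁ v' S' n') :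
    (F.seq G).Runs v S v' S' (n + n') :=
  (ReachesIn.graft (m' := (F.seq G).code) (g := .inl) (fun _ => rfl) h).trans
    (ReachesIn.graft (m' := (F.seq G).code) (g := .inr) (fun _ => rfl) h')

/-- Execute the statement `q`, and one of two programs according to its result. -/
def ite (q : Stmt Γ Bool σ) (F G : Frag Γ σ) : Frag Γ σ where
  Label := Option (F.Label ⊕ G.Label)
  entry := none
  code
    | none => graft (fun b => some (bif b then .inl F.entry else .inr G.entry)) .halt q
    | some (.inl l) => graft (fun l => some (.inl l)) .halt (F.code l)
    | some (.inr l) => graft (fun l => some (.inr l)) .halt (G.code l)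

theorem ite_runs_true {q : Stmt Γ Bool σ} {F G : Frag Γ σ} {v v₁ v' : σ}
    {S S₁ S' : ∀ k, List (Γ k)} {n : ℕ} (h : stepAux q v S = ⟨some true, v₁, S₁⟩)
    (h' : F.Runs v₁ S₁ v' S' n) : (ite q F G).Runs v S v' S' (n + 1) :=
  .head (by simp [ite, stepAux_graft, h, graftCfg])
    (ReachesIn.graft (m' := (ite q F G).code) (g := fun l => some (.inl l)) (fun _ => rfl) h')

theorem ite_runs_false {q : Stmt Γ Bool σ} {F G : Frag Γ σ} {v v₁ v' : σ}
    {S S₁ S' : ∀ k, List (Γ k)} {n : ℕ} (h : stepAux q v S = ⟨some false, v₁, S₁⟩)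
    (h' : G.Runs v₁ S₁ v' S' n) : (ite q F G).Runs v S v' S' (n + 1) :=
  .head (by simp [ite, stepAux_graft, h, graftCfg])
    (ReachesIn.graft (m' := (ite q F G).code) (g := fun l => some (.inr l)) (fun _ => rfl) h')

/-- Execute the statement `q`; unless it halts, run `F` and start again. -/
def repeatWhile (q : Stmt Γ Unit σ) (F : Frag Γ σ) : Frag Γ σ where
  Label := Option F.Label
  entry := none
  code
    | none => graft (fun _ => some F.entry) .halt q
    | some l => graft some (.goto fun _ => none) (F.code l)

theorem repeatWhile_exit {q : Stmt Γ Unit σ} {F : Frag Γ σ} {v v' : σ} {S S' : ∀ k, List (Γ k)}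
    (h : stepAux q v S = ⟨none, v', S'⟩) : (repeatWhile q F).Runs v S v' S' 1 :=
  .head (by simp [repeatWhile, stepAux_graft, h, graftCfg]) (.refl 0 _)

theorem repeatWhile_next {q : Stmt Γ Unit σ} {F : Frag Γ σ} {v v₁ v₂ v' : σ}
    {S S₁ S₂ S' : ∀ k, List (Γ k)} {n n' : ℕ} (h : stepAux q v S = ⟨some (), v₁, S₁⟩)
    (h' : F.Runs v₁ S₁ v₂ S₂ n) (h'' : (repeatWhile q F).Runs v₂ S₂ v' S' n') :
    (repeatWhile q F).Runs v S v' S' (n + n' + 1) :=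
  .head (by simp [repeatWhile, stepAux_graft, h, graftCfg])
    ((ReachesIn.graft (m' := (repeatWhile q F).code) (g := some) (fun _ => rfl) h').trans h'')

end Frag

/-! ### Embedding a machine into a machine with more stacks and more internal memory -/

section Lift

variable {K K₁ : Type} [DecidableEq K] [DecidableEq K₁] {Γ : K → Type} {σ σ₁ Λ : Type}

/-- The part `get` of the internal memory `σ` can be changed by `set`. -/
structure Lens (σ σ₁ : Type) where
  get : σ → σ₁
  set : σ → σ₁ → σ
  get_set : ∀ v a, get (set v a) = a
  set_set : ∀ v a b, set (set v a) b = set v b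
  set_get : ∀ v, set v (get v) = v

/-- The statement acting on the stacks `i k` and on a part of the internal memory. -/
def liftStmt (i : K₁ → K) (e : Lens σ σ₁) :
    Stmt (fun k => Γ (i k)) Λ σ₁ → Stmt Γ Λ σ
  | .push k f q => .push (i k) (fun v => f (e.get v)) (liftStmt i e q)
  | .peek k f q => .peek (i k) (fun v o => e.set v (f (e.get v) o)) (liftStmt i e q)
  | .pop k f q => .pop (i k) (fun v o => e.set v (f (e.get v) o)) (liftStmt i e q)
  | .load f q => .load (fun v => e.set v (f (e.get v))) (liftStmt i e q)
  | .branch f q₁ q₂ => .branch (fun v => f (e.get v)) (liftStmt i e q₁) (liftStmt i e q₂)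
  | .goto f => .goto fun v => f (e.get v)
  | .halt => .halt

/-- `c` is the restriction of `c'` to the stacks `i k` and a part of the internal memory; outside of
these, `c'` has the stacks `S` and the memory `v`. -/
structure LiftRel (i : K₁ → K) (e : Lens σ σ₁) (v : σ) (S : ∀ k, List (Γ k))
    (c : Cfg (fun k => Γ (i k)) Λ σ₁) (c' : Cfg Γ Λ σ) : Prop where
  label : c'.l = c.l
  var : c'.var = e.set v c.var
  stk : ∀ k, c'.stk (i k) = c.stk k
  rest : ∀ k, k ∉ Set.range i → c'.stk k = S k

theorem update_embedding {i : K₁ → K} (hi : Function.Injective i) {S S₀ : ∀ k, List (Γ k)}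
    {T : ∀ k, List (Γ (i k))} (hT : ∀ k, S (i k) = T k) (hS : ∀ k, k ∉ Set.range i → S k = S₀ k)
    (k : K₁) (x : List (Γ (i k))) :
    (∀ k', Function.update S (i k) x (i k') = Function.update T k x k') ∧
      ∀ k', k' ∉ Set.range i → Function.update S (i k) x k' = S₀ k' := by
  refine ⟨fun k' => ?_, fun k' h => ?_⟩
  · by_cases h : k' = k
    · subst h; simp
    · rw [Function.update_of_ne (hi.ne h), Function.update_of_ne h, hT]
  · rw [Function.update_of_ne (fun h' => h ⟨k, h'.symm⟩), hS _ h]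

/-- The simulation invariant is stated relative to the fixed outer memory `v₀` and outer stacks
`S₀`: a lifted statement writes only through `i` and `e`, so these survive the whole run. -/
theorem stepAux_liftStmt {i : K₁ → K} (hi : Function.Injective i) (e : Lens σ σ₁) (v₀ : σ)
    (S₀ : ∀ k, List (Γ k)) (q : Stmt (fun k => Γ (i k)) Λ σ₁) (v : σ) (S : ∀ k, List (Γ k))
    (T : ∀ k, List (Γ (i k))) (w : σ₁) (hv : v = e.set v₀ w) (hT : ∀ k, S (i k) = T k)
    (hS : ∀ k, k ∉ Set.range i → S k = S₀ k) :
    LiftRel i e v₀ S₀ (stepAux q w T) (stepAux (liftStmt i e q) v S) := by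
  have hw : e.get v = w := by rw [hv, e.get_set]
  have hset : ∀ w', e.set v w' = e.set v₀ w' := fun w' => by rw [hv, e.set_set]
  induction q generalizing v S T w with
  | push k f q ih =>
    obtain ⟨h₁, h₂⟩ := update_embedding hi hT hS k (f w :: T k)
    simp only [liftStmt, stepAux, hw, hT]
    exact ih _ _ _ _ hv h₁ h₂ hw hset
  | peek k f q ih =>
    simp only [liftStmt, stepAux, hw, hT, hset]
    exact ih _ _ _ _ rfl hT hS (e.get_set _ _) fun _ => e.set_set _ _ _
  | pop k f q ih =>
    obtain ⟨h₁, h₂⟩ := update_embedding hi hT hS k (T k).tail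
    simp only [liftStmt, stepAux, hw, hT, hset]
    exact ih _ _ _ _ rfl h₁ h₂ (e.get_set _ _) fun _ => e.set_set _ _ _
  | load f q ih =>
    simp only [liftStmt, stepAux, hw, hset]
    exact ih _ _ _ _ rfl hT hS (e.get_set _ _) fun _ => e.set_set _ _ _
  | branch f q₁ q₂ h₁ h₂ =>
    simp only [liftStmt, stepAux, hw]
    cases f w
    · exact h₂ _ _ _ _ hv hT hS hw hset
    · exact h₁ _ _ _ _ hv hT hS hw hset
  | goto f => exact ⟨by simp [liftStmt, hw], hv, hT, hS⟩
  | halt => exact ⟨rfl, hv, hT, hS⟩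

theorem ReachesIn.lift {i : K₁ → K} (hi : Function.Injective i) (e : Lens σ σ₁) {v : σ}
    {S : ∀ k, List (Γ k)} {m : Λ → Stmt (fun k => Γ (i k)) Λ σ₁} {n : ℕ}
    {c c₁ : Cfg (fun k => Γ (i k)) Λ σ₁} (h : ReachesIn m n c c₁) {d : Cfg Γ Λ σ}
    (hd : LiftRel i e v S c d) :
    ∃ d₁, ReachesIn (fun l => liftStmt i e (m l)) n d d₁ ∧ LiftRel i e v S c₁ d₁ := by
  induction h generalizing d with
  | refl n c => exact ⟨d, .refl _ _, hd⟩
  | @head n c c₁ c₂ hs _ ih =>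
    obtain ⟨_ | l, w, T⟩ := c
    · simp at hs
    obtain ⟨l', w', T'⟩ := d
    obtain ⟨rfl, hv, hT, hS⟩ := hd
    simp only [step, Option.some.injEq] at hs
    subst hs
    obtain ⟨d₁, h₁, h₂⟩ := ih (stepAux_liftStmt hi e v S (m l) w' T' T w hv hT hS)
    exact ⟨d₁, .head rfl h₁, h₂⟩

/-- The program acting on the stacks `i k` and on a part of the internal memory. -/
def Frag.lift (i : K₁ → K) (e : Lens σ σ₁) (F : Frag (fun k => Γ (i k)) σ₁) : Frag Γ σ where
  Label := F.Label
  entry := F.entry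
  code := fun l => liftStmt i e (F.code l)

theorem Frag.lift_runs {i : K₁ → K} (hi : Function.Injective i) (e : Lens σ σ₁)
    {F : Frag (fun k => Γ (i k)) σ₁} {v : σ} {S S' : ∀ k, List (Γ k)} {w : σ₁} {n : ℕ}
    (h : F.Runs (e.get v) (fun k => S (i k)) w (fun k => S' (i k)) n)
    (hS : ∀ k, k ∉ Set.range i → S' k = S k) :
    (F.lift i e).Runs v S (e.set v w) S' n := by
  obtain ⟨⟨l, v₁, S₁⟩, h₁, h₂, h₃, h₄, h₅⟩ := ReachesIn.lift hi e (v := v) (S := S) h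
    (d := ⟨some F.entry, v, S⟩) ⟨rfl, (e.set_get v).symm, fun _ => rfl, fun _ _ => rfl⟩
  obtain rfl : l = none := h₂
  obtain rfl : v₁ = e.set v w := h₃
  obtain rfl : S₁ = S' := by
    funext k
    by_cases hk : k ∈ Set.range i
    · obtain ⟨k, rfl⟩ := hk
      exact h₄ k
    · rw [hS k hk]
      exact h₅ k hk
  exact h₁

end Lift

end StackProgram

/-! ### A machine that computes with trees -/

namespace StackProgram

open Turing.TM2

/-- Binary trees, the data of our computations. -/
inductive Data : Type
  | nil
  | cons (x y : Data)

/-- The prefix code of a tree. -/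
def Data.code : Data → List Bool
  | .nil => [false]
  | .cons x y => true :: (x.code ++ y.code)

/-- The stacks of the machine: trees are stored on the stack `main`, the other stacks are empty
between the operations. -/
inductive Reg : Type
  | main | a | b | c | ctr
  deriving DecidableEq

instance : Fintype Reg :=
  ⟨{.main, .a, .b, .c, .ctr}, by intro r; cases r <;> decide⟩

/-- The contents of the stacks. -/
def regs (m a b c k : List Bool) : Reg → List Bool
  | .main => m
  | .a => a
  | .b => b
  | .c => c
  | .ctr => k

/-- The programs of the machine; the internal memory holds the last symbol that was read. -/
abbrev Prog : Type 1 := Frag (fun _ : Reg => Bool) (Option Bool)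

/-- The statements of the machine. -/
abbrev ProgStmt (Λ : Type) : Type := Stmt (fun _ : Reg => Bool) Λ (Option Bool)

/-- Started with the trees with code `m` on the stack, `F` computes the trees with code `m'`. -/
def Prog.Computes (F : Prog) (m m' : List Bool) (n : ℕ) : Prop :=
  F.Runs none (regs m [] [] [] []) none (regs m' [] [] [] []) n

theorem Prog.Computes.mono {F : Prog} {m m' : List Bool} {n n' : ℕ} (h : F.Computes m m' n)
    (hn : n ≤ n') : F.Computes m m' n' :=
  Frag.Runs.mono h hn

theorem Prog.Computes.seq {F G : Prog} {m m₁ m' : List Bool} {n n' : ℕ} (h : F.Computes m m₁ n)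
    (h' : G.Computes m₁ m' n') : Prog.Computes (F.seq G) m m' (n + n') :=
  Frag.seq_runs h h'

namespace Prog

/-- Stacks that agree with `S` except for `main`, `ctr` and `j`. -/
def stacksAt (S : Reg → List Bool) (j : Reg) (m k A : List Bool) : Reg → List Bool :=
  fun r => if r = .main then m else if r = .ctr then k else if r = j then A else S r

/-- Move the uppermost tree from `main` to the stack `j`. -/
def moveStmt (j : Reg) : ProgStmt Unit :=
  .pop .main (fun _ o => o) <| .branch (fun v => v == some true)
    (.push j (fun _ => true) <| .push .ctr (fun _ => true) <| .goto fun _ => ())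
    (.push j (fun _ => false) <| .pop .ctr (fun _ o => o) <|
      .branch Option.isSome (.goto fun _ => ()) .halt)

/-- The stack `ctr` holds one entry per right subtree that is still to be read: an inner node pushes
an entry, a leaf pops one, and the tree ends at the leaf that finds `ctr` empty. Arbitrary `k` is
needed for the induction, since the left subtree is read with one more entry than the right one. -/
theorem move_reachesIn (S : Reg → List Bool) (j : Reg) (hm : j ≠ .main) (hc : j ≠ .ctr) (x : Data)
    (v : Option Bool) (rest k A : List Bool) :
    ReachesIn (Frag.loop (moveStmt j)).code x.code.length
      ⟨some (), v, stacksAt S j (x.code ++ rest) k A⟩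
      ⟨if k = [] then none else some (), k.head?,
        stacksAt S j rest k.tail (x.code.reverse ++ A)⟩ := by
  have h1 : ∀ m k A m', Function.update (stacksAt S j m k A) .main m' = stacksAt S j m' k A := by
    intro m k A m'; funext r; simp only [Function.update_apply, stacksAt]; split_ifs <;> simp_all
  have h2 : ∀ m k A k', Function.update (stacksAt S j m k A) .ctr k' = stacksAt S j m k' A := by
    intro m k A k'; funext r; simp only [Function.update_apply, stacksAt]; split_ifs <;> simp_all
  have h3 : ∀ m k A A', Function.update (stacksAt S j m k A) j A' = stacksAt S j m k A' := by
    intro m k A A'; funext r; simp only [Function.update_apply, stacksAt]; split_ifs <;> simp_all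
  have h4 : ∀ m k A, stacksAt S j m k A .main = m := fun m k A => rfl
  have h5 : ∀ m k A, stacksAt S j m k A .ctr = k := fun m k A => rfl
  have h6 : ∀ m k A, stacksAt S j m k A j = A := fun m k A => by simp [stacksAt, hm, hc]
  induction x generalizing v rest k A with
  | nil =>
    refine .head (n := 0) ?_ (.refl 0 _)
    cases k <;> simp [Frag.loop, moveStmt, Data.code, h1, h2, h3, h4, h5, h6]
  | cons x y ihx ihy =>
    have e : (Data.cons x y).code.length = x.code.length + y.code.length + 1 := by
      simp [Data.code]
    rw [e]
    refine .head ?_ ((ihx (some true) (y.code ++ rest) (true :: k) (true :: A)).trans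
      (n' := y.code.length) ?_)
    · simp [Frag.loop, moveStmt, Data.code, h1, h2, h3, h4, h5, h6]
    · simpa [Data.code] using ihy (some true) rest k (x.code.reverse ++ true :: A)

/-- Move the uppermost tree from `main` to the stack `j`. -/
def move (j : Reg) : Prog := Frag.loop (moveStmt j)

theorem move_runs {j : Reg} (hm : j ≠ .main) (hc : j ≠ .ctr) {S T : Reg → List Bool} (x : Data)
    (rest : List Bool) (h₁ : S .main = x.code ++ rest) (h₂ : S .ctr = []) (h₃ : T .main = rest)
    (h₄ : T .ctr = []) (h₅ : T j = x.code.reverse ++ S j)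
    (h₆ : ∀ r, r ≠ .main → r ≠ .ctr → r ≠ j → T r = S r) :
    (move j).Runs none S none T x.code.length := by
  have := move_reachesIn S j hm hc x none rest [] (S j)
  have e₁ : stacksAt S j (x.code ++ rest) [] (S j) = S := by
    funext r; simp only [stacksAt]; split_ifs <;> simp_all
  have e₂ : stacksAt S j rest [] (x.code.reverse ++ S j) = T := by
    funext r; simp only [stacksAt]; split_ifs <;> simp_all
  rw [e₁] at this
  simp only [List.tail_nil, e₂] at this
  exact this

/-- Move the whole stack `i` to `j`, reversing it. -/
def transfer (i j : Reg) : Prog :=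
  Frag.loop <| .pop i (fun _ o => o) <| .branch Option.isSome
    (.push j (fun v => v.getD false) <| .goto fun _ => ()) .halt

theorem transfer_runs {i j : Reg} (hij : j ≠ i) (l : List Bool) {S T : Reg → List Bool}
    (v : Option Bool) (h₁ : S i = l) (h₂ : T i = []) (h₃ : T j = l.reverse ++ S j)
    (h₄ : ∀ r, r ≠ i → r ≠ j → T r = S r) :
    (transfer i j).Runs v S none T (l.length + 1) := by
  induction l generalizing S v with
  | nil =>
    obtain rfl : S = T := by
      funext r
      by_cases hi : r = i
      · rw [hi, h₁, h₂]
      by_cases hj : r = j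
      · rw [hj, h₃]; rfl
      exact (h₄ r hi hj).symm
    refine Frag.loop_exit ?_
    simp [h₁]
  | cons x l ih =>
    refine Frag.loop_next (v₁ := some x)
      (S₁ := Function.update (Function.update S i l) j (x :: S j)) ?_ (ih _ ?_ ?_ ?_)
    · simp [h₁, Function.update_of_ne hij]
    · simp [Function.update_of_ne hij.symm]
    · simp [h₃]
    · intro r hi hj
      simp [Function.update_of_ne hi, Function.update_of_ne hj, h₄ r hi hj]

/-- Move the whole stack `i` to `j` and to `k`, reversing it. -/
def copy (i j k : Reg) : Prog :=
  Frag.loop <| .pop i (fun _ o => o) <| .branch Option.isSome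
    (.push j (fun v => v.getD false) <| .push k (fun v => v.getD false) <| .goto fun _ => ()) .halt

theorem copy_runs {i j k : Reg} (hij : j ≠ i) (hik : k ≠ i) (hjk : k ≠ j) (l : List Bool)
    {S T : Reg → List Bool} (v : Option Bool) (h₁ : S i = l) (h₂ : T i = [])
    (h₃ : T j = l.reverse ++ S j) (h₄ : T k = l.reverse ++ S k)
    (h₅ : ∀ r, r ≠ i → r ≠ j → r ≠ k → T r = S r) :
    (copy i j k).Runs v S none T (l.length + 1) := by
  induction l generalizing S v with
  | nil =>
    obtain rfl : S = T := by
      funext r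
      by_cases hi : r = i
      · rw [hi, h₁, h₂]
      by_cases hj : r = j
      · rw [hj, h₃]; rfl
      by_cases hk : r = k
      · rw [hk, h₄]; rfl
      exact (h₅ r hi hj hk).symm
    refine Frag.loop_exit ?_
    simp [h₁]
  | cons x l ih =>
    refine Frag.loop_next (v₁ := some x)
      (S₁ := Function.update (Function.update (Function.update S i l) j (x :: S j)) k (x :: S k))
      ?_ (ih _ ?_ ?_ ?_ ?_)
    · simp [h₁, Function.update_of_ne hij, Function.update_of_ne hik, Function.update_of_ne hjk]
    · simp [Function.update_of_ne hij.symm, Function.update_of_ne hik.symm]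
    · simp [h₃, Function.update_of_ne hjk.symm]
    · simp [h₄]
    · intro r hi hj hk
      simp [Function.update_of_ne hi, Function.update_of_ne hj, Function.update_of_ne hk,
        h₅ r hi hj hk]

/-- Empty the stack `i`. -/
def clear (i : Reg) : Prog :=
  Frag.loop <| .pop i (fun _ o => o) <| .branch Option.isSome (.goto fun _ => ()) .halt

theorem clear_runs {i : Reg} (l : List Bool) {S T : Reg → List Bool} (v : Option Bool)
    (h₁ : S i = l) (h₂ : T i = []) (h₃ : ∀ r, r ≠ i → T r = S r) :
    (clear i).Runs v S none T (l.length + 1) := by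
  induction l generalizing S v with
  | nil =>
    obtain rfl : S = T := by
      funext r
      by_cases hi : r = i
      · rw [hi, h₁, h₂]
      exact (h₃ r hi).symm
    refine Frag.loop_exit ?_
    simp [h₁]
  | cons x l ih =>
    refine Frag.loop_next (v₁ := some x) (S₁ := Function.update S i l) ?_ (ih _ ?_ ?_)
    · simp [h₁]
    · simp
    · intro r hi
      simp [Function.update_of_ne hi, h₃ r hi]

/-- Push a symbol on `main`. -/
def push (s : Bool) : Prog :=
  Frag.loop <| .push .main (fun _ => s) .halt

theorem push_computes (s : Bool) (m : List Bool) : (push s).Computes m (s :: m) 1 := by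
  refine Frag.loop_exit ?_
  simp only [stepAux, Cfg.mk.injEq, true_and]
  funext r; cases r <;> rfl

/-- Remove the uppermost symbol of `main`. -/
def pop : Prog :=
  Frag.loop <| .pop .main (fun _ _ => none) .halt

theorem pop_computes (s : Bool) (m : List Bool) : pop.Computes (s :: m) m 1 := by
  refine Frag.loop_exit ?_
  simp only [stepAux, Cfg.mk.injEq, true_and]
  funext r; cases r <;> rfl

/-- Remove the uppermost tree. -/
def drop : Prog := (move .a).seq (clear .a)

theorem drop_computes (x : Data) (m : List Bool) :
    drop.Computes (x.code ++ m) m (2 * x.code.length + 1) := by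
  refine (Frag.seq_runs (S₁ := regs m x.code.reverse [] [] [])
    (move_runs ?_ ?_ x m rfl rfl rfl rfl ?_ ?_) (clear_runs x.code.reverse none rfl rfl ?_)).mono ?_
  · decide
  · decide
  · simp [regs]
  · rintro (_ | _) <;> simp [regs]
  · rintro (_ | _) <;> simp [regs]
  · simp; omega

/-- Duplicate the uppermost tree. -/
def dup : Prog :=
  (move .a).seq <| (copy .a .main .b).seq <| (transfer .b .a).seq (transfer .a .main)

/-- Every pass from one stack to another reverses the word, so a tree must be passed an even number
of times before it is back on `main`; this explains the detour from `b` through `a`. -/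
theorem dup_computes (x : Data) (m : List Bool) :
    dup.Computes (x.code ++ m) (x.code ++ (x.code ++ m)) (4 * x.code.length + 3) := by
  refine (Frag.seq_runs (S₁ := regs m x.code.reverse [] [] [])
    (move_runs ?_ ?_ x m rfl rfl rfl rfl ?_ ?_) <|
    Frag.seq_runs (S₁ := regs (x.code ++ m) [] x.code [] [])
    (copy_runs ?_ ?_ ?_ x.code.reverse none rfl rfl ?_ ?_ ?_) <|
    Frag.seq_runs (S₁ := regs (x.code ++ m) x.code.reverse [] [] [])
    (transfer_runs ?_ x.code none rfl rfl ?_ ?_)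
    (transfer_runs ?_ x.code.reverse none rfl rfl ?_ ?_)).mono ?_
  any_goals first | decide | (simp [regs]; done) | (rintro (_ | _) <;> simp [regs])
  simp; omega

/-- Exchange the two uppermost trees. -/
def swap : Prog :=
  (move .a).seq <| (move .b).seq <| (transfer .a .main).seq (transfer .b .main)

theorem swap_computes (x y : Data) (m : List Bool) :
    swap.Computes (x.code ++ (y.code ++ m)) (y.code ++ (x.code ++ m))
      (2 * x.code.length + 2 * y.code.length + 2) := by
  refine (Frag.seq_runs (S₁ := regs (y.code ++ m) x.code.reverse [] [] [])
    (move_runs ?_ ?_ x (y.code ++ m) rfl rfl rfl rfl ?_ ?_) <|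
    Frag.seq_runs (S₁ := regs m x.code.reverse y.code.reverse [] [])
    (move_runs ?_ ?_ y m rfl rfl rfl rfl ?_ ?_) <|
    Frag.seq_runs (S₁ := regs (x.code ++ m) [] y.code.reverse [] [])
    (transfer_runs ?_ x.code.reverse none rfl rfl ?_ ?_)
    (transfer_runs ?_ y.code.reverse none rfl rfl ?_ ?_)).mono ?_
  any_goals first | decide | (simp [regs]; done) | (rintro (_ | _) <;> simp [regs])
  simp; omega

/-- Exchange the second and the third tree. -/
def swapBelow : Prog :=
  (move .a).seq <| (move .b).seq <| (move .c).seq <|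
    (transfer .b .main).seq <| (transfer .c .main).seq (transfer .a .main)

theorem swapBelow_computes (x y z : Data) (m : List Bool) :
    swapBelow.Computes (x.code ++ (y.code ++ (z.code ++ m))) (x.code ++ (z.code ++ (y.code ++ m)))
      (2 * x.code.length + 2 * y.code.length + 2 * z.code.length + 3) := by
  refine (Frag.seq_runs (S₁ := regs (y.code ++ (z.code ++ m)) x.code.reverse [] [] [])
    (move_runs ?_ ?_ x _ rfl rfl rfl rfl ?_ ?_) <|
    Frag.seq_runs (S₁ := regs (z.code ++ m) x.code.reverse y.code.reverse [] [])
    (move_runs ?_ ?_ y _ rfl rfl rfl rfl ?_ ?_) <|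
    Frag.seq_runs (S₁ := regs m x.code.reverse y.code.reverse z.code.reverse [])
    (move_runs ?_ ?_ z _ rfl rfl rfl rfl ?_ ?_) <|
    Frag.seq_runs (S₁ := regs (y.code ++ m) x.code.reverse [] z.code.reverse [])
    (transfer_runs ?_ y.code.reverse none rfl rfl ?_ ?_) <|
    Frag.seq_runs (S₁ := regs (z.code ++ (y.code ++ m)) x.code.reverse [] [] [])
    (transfer_runs ?_ z.code.reverse none rfl rfl ?_ ?_)
    (transfer_runs ?_ x.code.reverse none rfl rfl ?_ ?_)).mono ?_
  any_goals first | decide | (simp [regs]; done) | (rintro (_ | _) <;> simp [regs])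
  simp; omega

/-- Test whether the uppermost symbol of `main` is `true`, and remove it. -/
def testStmt : ProgStmt Bool :=
  .pop .main (fun _ o => o) <| .branch (fun v => v == some true)
    (.load (fun _ => none) <| .goto fun _ => true)
    (.load (fun _ => none) <| .goto fun _ => false)

theorem stepAux_testStmt (s : Bool) (m : List Bool) :
    stepAux testStmt none (regs (s :: m) [] [] [] []) =
      ⟨some s, none, regs m [] [] [] []⟩ := by
  have : Function.update (regs (s :: m) [] [] [] []) .main m = regs m [] [] [] [] := by
    funext r; cases r <;> rfl
  cases s <;> simp [testStmt, this, regs]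

/-- Remove the uppermost symbol of `main`, and exit unless it is `true`. -/
def whileStmt : ProgStmt Unit :=
  .pop .main (fun _ o => o) <| .branch (fun v => v == some true)
    (.load (fun _ => none) <| .goto fun _ => ()) (.load (fun _ => none) <| .halt)

theorem stepAux_whileStmt (s : Bool) (m : List Bool) :
    stepAux whileStmt none (regs (s :: m) [] [] [] []) =
      ⟨bif s then some () else none, none, regs m [] [] [] []⟩ := by
  have : Function.update (regs (s :: m) [] [] [] []) .main m = regs m [] [] [] [] := by
    funext r; cases r <;> rfl
  cases s <;> simp [whileStmt, this, regs]

end Prog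

end StackProgram

/-! ### Functions that are computable in polynomial time -/

namespace StackProgram

/-- Types whose elements are represented by trees. -/
class ToData (α : Type) where
  toData : α → Data

section

variable {α β γ δ : Type} [ToData α] [ToData β] [ToData γ] [ToData δ]

/-- The code of an element. -/
def code (x : α) : List Bool := (ToData.toData x).code

/-- The size of the representation of an element. -/
def size (x : α) : ℕ := (code x).length

theorem size_pos (x : α) : 0 < size x := by
  unfold size code
  cases ToData.toData x <;> simp [Data.code]

/-- Pairs and non-empty lists use the same tree constructor, so `(a, l)` and `a :: l` have the same
code and passing from one to the other is free. -/
instance : ToData (α × β) := ⟨fun x => .cons (ToData.toData x.1) (ToData.toData x.2)⟩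

instance : ToData Unit := ⟨fun _ => .nil⟩

instance : ToData Bool := ⟨fun b => bif b then .cons .nil .nil else .nil⟩

instance : ToData (List α) := ⟨fun l => l.foldr (fun a d => .cons (ToData.toData a) d) .nil⟩

/-- A number is the tree of a list of that many units: numbers are unary, and list programs apply to
them. -/
instance : ToData ℕ := ⟨Nat.rec .nil fun _ d => .cons .nil d⟩

theorem code_pair (a : α) (b : β) : code (a, b) = true :: (code a ++ code b) := rfl
theorem code_cons (a : α) (l : List α) : code (a :: l) = true :: (code a ++ code l) := rfl
theorem code_true : code true = [true, false, false] := rfl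

@[simp] theorem size_pair (a : α) (b : β) : size (a, b) = size a + size b + 1 := by
  simp [size, code_pair]
@[simp] theorem size_nil : size ([] : List α) = 1 := rfl
@[simp] theorem size_cons (a : α) (l : List α) : size (a :: l) = size a + size l + 1 := by
  simp [size, code_cons]
@[simp] theorem size_unit (a : Unit) : size a = 1 := rfl
theorem size_bool (b : Bool) : size b ≤ 3 := by cases b <;> decide
theorem size_nat (n : ℕ) : size n = 2 * n + 1 := by
  induction n with
  | zero => rfl
  | succ n ih =>
    have : size (n + 1) = 1 + size n + 1 := size_pair () n
    omega

theorem length_le_size (l : List α) : l.length ≤ size l := by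
  induction l with
  | nil => simp
  | cons a l ih => simp; omega

theorem size_append (l l' : List α) : size (l ++ l') + 1 = size l + size l' := by
  induction l with
  | nil => simp; omega
  | cons a l ih => simp; omega

theorem size_filter_le (p : α → Bool) (l : List α) : size (l.filter p) ≤ size l := by
  induction l with
  | nil => simp
  | cons b l ih => rw [List.filter_cons]; split <;> simp <;> omega

/-- The coefficients are natural numbers, so every polynomial is monotone and size bounds can be
substituted into time bounds. -/
theorem eval_mono (p : Polynomial ℕ) {m n : ℕ} (h : m ≤ n) : p.eval m ≤ p.eval n := by
  induction p using Polynomial.induction_on' with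
  | add p q hp hq => simpa using add_le_add hp hq
  | monomial k a => simpa using Nat.mul_le_mul_left a (Nat.pow_le_pow_left h k)

/-- `f` is computable in polynomial time, in the size of the representation of its argument. -/
def PolyTime (f : α → β) : Prop :=
  ∃ (F : Prog) (p : Polynomial ℕ), ∀ x, size (f x) ≤ p.eval (size x) ∧
    ∀ rest, F.Computes (code x ++ rest) (code (f x) ++ rest) (p.eval (size x))

/-! ### Closure of polynomial time under composition, pairing, case distinction and folds -/

namespace PolyTime

theorem of_eq {f g : α → β} (hf : PolyTime f) (h : ∀ x, f x = g x) : PolyTime g :=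
  (funext h : f = g) ▸ hf

/-- The program halts at once. This serves for changes of type that leave the tree as it is. -/
theorem of_code_eq {f : α → β} (h : ∀ x, code (f x) = code x) : PolyTime f := by
  refine ⟨Frag.loop .halt, Polynomial.X + 1, fun x => ⟨?_, fun rest => ?_⟩⟩
  · simp [size, h]
  · rw [h]
    exact Prog.Computes.mono (Frag.loop_exit rfl) (by simp)

protected theorem id : PolyTime (fun x : α => x) := of_code_eq fun _ => rfl

theorem size_le {f : α → β} (hf : PolyTime f) :
    ∃ p : Polynomial ℕ, ∀ x, size (f x) ≤ p.eval (size x) :=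
  let ⟨_, p, h⟩ := hf
  ⟨p, fun x => (h x).1⟩

/-- The second program runs on `f x`, whose size is at most `p`; this is where the size bound in
`PolyTime` is used. -/
theorem comp {g : β → γ} {f : α → β} (hg : PolyTime g) (hf : PolyTime f) :
    PolyTime fun x => g (f x) := by
  obtain ⟨F, p, hF⟩ := hf
  obtain ⟨G, q, hG⟩ := hg
  refine ⟨F.seq G, p + q.comp p, fun x => ?_⟩
  obtain ⟨h₁, h₂⟩ := hF x
  obtain ⟨h₃, h₄⟩ := hG (f x)
  have h₅ := eval_mono q h₁
  simp only [Polynomial.eval_add, Polynomial.eval_comp]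
  exact ⟨by omega, fun rest => ((h₂ rest).seq (h₄ rest)).mono (by omega)⟩

theorem pair {f : α → β} {g : α → γ} (hf : PolyTime f) (hg : PolyTime g) :
    PolyTime fun x => (f x, g x) := by
  obtain ⟨F, p, hF⟩ := hf
  obtain ⟨G, q, hG⟩ := hg
  -- `g` is evaluated first, so that after the exchange and the run of `F` the value `f x` lies
  -- above `g x`, as the code of the pair requires.
  refine ⟨Prog.dup.seq <| G.seq <| Prog.swap.seq <| F.seq (Prog.push true),
    6 * Polynomial.X + 3 * q + 2 * p + 10, fun x => ?_⟩
  obtain ⟨h₁, h₂⟩ := hF x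
  obtain ⟨h₃, h₄⟩ := hG x
  simp only [Polynomial.eval_add, Polynomial.eval_mul, Polynomial.eval_X, Polynomial.eval_ofNat,
    size_pair]
  refine ⟨by omega, fun rest => ?_⟩
  have := (Prog.dup_computes (ToData.toData x) rest).seq <| (h₄ (code x ++ rest)).seq <|
    (Prog.swap_computes (ToData.toData (g x)) (ToData.toData x) rest).seq <|
    (h₂ (code (g x) ++ rest)).seq (Prog.push_computes true _)
  rw [code_pair, List.cons_append, List.append_assoc]
  refine this.mono ?_
  change 4 * size x + 3 + (_ + (2 * size (g x) + 2 * size x + 2 + _)) ≤ _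
  omega

theorem fst : PolyTime (Prod.fst : α × β → α) := by
  refine ⟨Prog.pop.seq <| Prog.swap.seq Prog.drop, 4 * Polynomial.X + 10, fun x => ?_⟩
  simp only [Polynomial.eval_add, Polynomial.eval_mul, Polynomial.eval_X, Polynomial.eval_ofNat]
  obtain ⟨a, b⟩ := x
  refine ⟨by simp; omega, fun rest => ?_⟩
  have := (Prog.pop_computes true (code a ++ (code b ++ rest))).seq <|
    (Prog.swap_computes (ToData.toData a) (ToData.toData b) rest).seq <|
    Prog.drop_computes (ToData.toData b) (code a ++ rest)
  rw [code_pair, List.cons_append, List.append_assoc]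
  refine this.mono ?_
  change 1 + (2 * size a + 2 * size b + 2 + (2 * size b + 1)) ≤ _
  simp; omega

theorem snd : PolyTime (Prod.snd : α × β → β) := by
  refine ⟨Prog.pop.seq Prog.drop, 4 * Polynomial.X + 10, fun x => ?_⟩
  simp only [Polynomial.eval_add, Polynomial.eval_mul, Polynomial.eval_X, Polynomial.eval_ofNat]
  obtain ⟨a, b⟩ := x
  refine ⟨by simp; omega, fun rest => ?_⟩
  have := (Prog.pop_computes true (code a ++ (code b ++ rest))).seq <|
    Prog.drop_computes (ToData.toData a) (code b ++ rest)
  rw [code_pair, List.cons_append, List.append_assoc]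
  refine this.mono ?_
  change 1 + (2 * size a + 1) ≤ _
  simp; omega

/-- Push a word on `main`. -/
def pushWord : List Bool → Prog
  | [] => Frag.loop .halt
  | s :: l => (pushWord l).seq (Prog.push s)

theorem pushWord_computes (l m : List Bool) :
    (pushWord l).Computes m (l ++ m) (l.length + 1) := by
  induction l with
  | nil => exact Frag.loop_exit rfl
  | cons s l ih => exact (ih.seq (Prog.push_computes s _)).mono (by simp)

theorem const (b : β) : PolyTime fun _ : α => b := by
  refine ⟨Prog.drop.seq (pushWord (code b)), 2 * Polynomial.X + 2 + Polynomial.C (size b),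
    fun x => ?_⟩
  simp only [Polynomial.eval_add, Polynomial.eval_mul, Polynomial.eval_X, Polynomial.eval_ofNat,
    Polynomial.eval_C]
  refine ⟨by omega, fun rest => ?_⟩
  refine ((Prog.drop_computes (ToData.toData x) rest).seq (pushWord_computes (code b) rest)).mono ?_
  change 2 * size x + 1 + (size b + 1) ≤ _
  omega

theorem cond {p : α → Bool} {f g : α → β} (hp : PolyTime p) (hf : PolyTime f) (hg : PolyTime g) :
    PolyTime fun x => bif p x then f x else g x := by
  obtain ⟨P, r, hP⟩ := hp
  obtain ⟨F, p', hF⟩ := hf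
  obtain ⟨G, q, hG⟩ := hg
  -- The code of `true` is a node with two leaves; the test consumes the node, and the two
  -- `Prog.pop` remove the leaves. The code of `false` is a single leaf, which the test consumes
  -- entirely.
  refine ⟨Prog.dup.seq <| P.seq <| Frag.ite Prog.testStmt (Prog.pop.seq <| Prog.pop.seq F) G,
    4 * Polynomial.X + r + p' + q + 10, fun x => ?_⟩
  obtain ⟨h₁, h₂⟩ := hF x
  obtain ⟨h₃, h₄⟩ := hG x
  obtain ⟨-, h₅⟩ := hP x
  simp only [Polynomial.eval_add, Polynomial.eval_mul, Polynomial.eval_X, Polynomial.eval_ofNat]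
  refine ⟨by cases p x <;> simp <;> omega, fun rest => ?_⟩
  have e : 4 * (ToData.toData x).code.length + 3 = 4 * size x + 3 := rfl
  replace h₅ := h₅ (code x ++ rest)
  have h₇ := Prog.dup_computes (ToData.toData x) rest
  rw [e] at h₇
  cases h : p x
  · rw [h] at h₅
    refine (h₇.seq (h₅.seq (n' := q.eval (size x) + 1) ?_)).mono (by omega)
    exact Frag.ite_runs_false (Prog.stepAux_testStmt false _) (h₄ rest)
  · rw [h] at h₅
    refine (h₇.seq (h₅.seq (n' := 1 + (1 + p'.eval (size x)) + 1) ?_)).mono (by omega)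
    exact Frag.ite_runs_true (Prog.stepAux_testStmt true _)
      ((Prog.pop_computes _ _).seq ((Prog.pop_computes _ _).seq (h₂ rest)))

theorem cons {f : α → β} {g : α → List β} (hf : PolyTime f) (hg : PolyTime g) :
    PolyTime fun x => f x :: g x :=
  (of_code_eq (α := β × List β) (f := fun x => x.1 :: x.2) fun _ => rfl).comp (hf.pair hg)

/-- The first symbol of the code tells a non-empty list from the empty one, so the list can be
tested like a truth value. -/
theorem isEmpty : PolyTime (List.isEmpty : List α → Bool) := by
  refine ⟨Frag.ite Prog.testStmt (Prog.drop.seq <| Prog.drop.seq <| Prog.push false)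
    (pushWord (code true)), 4 * Polynomial.X + 10, fun l => ?_⟩
  simp only [Polynomial.eval_add, Polynomial.eval_mul, Polynomial.eval_X, Polynomial.eval_ofNat]
  refine ⟨(size_bool _).trans (by omega), fun rest => ?_⟩
  cases l with
  | nil =>
    exact Prog.Computes.mono (Frag.ite_runs_false (Prog.stepAux_testStmt false _)
      (pushWord_computes _ rest)) (by simp [code_true])
  | cons a l =>
    have := (Prog.drop_computes (ToData.toData a) (code l ++ rest)).seq
      ((Prog.drop_computes (ToData.toData l) rest).seq (Prog.push_computes false rest))
    rw [code_cons, List.cons_append, List.append_assoc]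
    refine Prog.Computes.mono (Frag.ite_runs_true (Prog.stepAux_testStmt true _) this) ?_
    change 2 * size a + 1 + (2 * size l + 1 + 1) + 1 ≤ _
    simp; omega

theorem tail : PolyTime (List.tail : List α → List α) := by
  refine ⟨Frag.ite Prog.testStmt Prog.drop (Prog.push false), 4 * Polynomial.X + 10, fun l => ?_⟩
  simp only [Polynomial.eval_add, Polynomial.eval_mul, Polynomial.eval_X, Polynomial.eval_ofNat]
  cases l with
  | nil =>
    exact ⟨by simp, fun rest => Prog.Computes.mono
      (Frag.ite_runs_false (Prog.stepAux_testStmt false _) (Prog.push_computes _ rest)) (by simp)⟩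
  | cons a l =>
    refine ⟨by simp; omega, fun rest => ?_⟩
    rw [code_cons, List.cons_append, List.append_assoc]
    refine Prog.Computes.mono (Frag.ite_runs_true (Prog.stepAux_testStmt true _)
      (Prog.drop_computes (ToData.toData a) (code l ++ rest))) ?_
    change 2 * size a + 1 + 1 ≤ _
    simp; omega

theorem headD (d : α) : PolyTime (fun l : List α => l.headD d) := by
  refine ⟨Frag.ite Prog.testStmt (Prog.swap.seq Prog.drop) (pushWord (code d)),
    4 * Polynomial.X + 10 + Polynomial.C (size d), fun l => ?_⟩
  simp only [Polynomial.eval_add, Polynomial.eval_mul, Polynomial.eval_X, Polynomial.eval_ofNat,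
    Polynomial.eval_C]
  cases l with
  | nil =>
    exact ⟨by simp, fun rest => Prog.Computes.mono
      (Frag.ite_runs_false (Prog.stepAux_testStmt false _) (pushWord_computes _ rest))
      (by change size d + 1 + 1 ≤ _; omega)⟩
  | cons a l =>
    refine ⟨by simp; omega, fun rest => ?_⟩
    rw [code_cons, List.cons_append, List.append_assoc]
    refine Prog.Computes.mono (Frag.ite_runs_true (Prog.stepAux_testStmt true _)
      ((Prog.swap_computes (ToData.toData a) (ToData.toData l) rest).seq
        (Prog.drop_computes (ToData.toData l) (code a ++ rest)))) ?_
    change 2 * size a + 2 * size l + 2 + (2 * size l + 1) + 1 ≤ _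
    simp; omega

/-- Iterating a polynomial-time step can make the accumulator grow exponentially, hence the
hypothesis `hq` on the result. Applied to the prefixes of the list, it bounds all intermediate
accumulators. -/
theorem foldl {f : α × β → β} (hf : PolyTime f) (q : Polynomial ℕ)
    (hq : ∀ (l : List α) (s : β), size (l.foldl (fun s a => f (a, s)) s) ≤ q.eval (size l + size s)) :
    PolyTime fun x : List α × β => x.1.foldl (fun s a => f (a, s)) x.2 := by
  obtain ⟨F, p, hF⟩ := hf
  -- The stack holds the remaining list above the accumulator. The test consumes the root of the
  -- list and leaves `a`, `l`, `s`; the exchange gives `a`, `s`, `l`, the pushed symbol joins `a`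
  -- and `s` into a pair for `F`, and the last exchange restores the order.
  set W : Prog := Frag.repeatWhile Prog.whileStmt
    (Prog.swapBelow.seq <| (Prog.push true).seq <| F.seq Prog.swap) with hW
  have main : ∀ (Q : ℕ) (l : List α) (s : β) (rest : List Bool), size l ≤ Q →
      (∀ l₁ l₂, l = l₁ ++ l₂ → size (l₁.foldl (fun s a => f (a, s)) s) ≤ Q) →
      W.Computes (code l ++ (code s ++ rest)) (code (l.foldl (fun s a => f (a, s)) s) ++ rest)
        (l.length * (10 * Q + p.eval (2 * Q + 1) + 10) + 1) := by
    intro Q l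
    induction l with
    | nil =>
      intro s rest _ _
      exact Prog.Computes.mono (Frag.repeatWhile_exit (Prog.stepAux_whileStmt false _)) (by simp)
    | cons a l ih =>
      intro s rest hl h
      have ih := ih (f (a, s)) rest (by simp at hl; omega) fun l₁ l₂ e => by
        simpa using h (a :: l₁) l₂ (by simp [e])
      have hs : size s ≤ Q := by simpa using h [] (a :: l) rfl
      have hs' : size (f (a, s)) ≤ Q := by simpa using h [a] l rfl
      simp only [size_cons] at hl
      have h₁ := Prog.swapBelow_computes (ToData.toData a) (ToData.toData l) (ToData.toData s) rest
      have h₂ := Prog.push_computes true (code a ++ (code s ++ (code l ++ rest)))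
      have h₃ := (hF (a, s)).2 (code l ++ rest)
      rw [code_pair, List.cons_append, List.append_assoc] at h₃
      have h₄ := Prog.swap_computes (ToData.toData (f (a, s))) (ToData.toData l) rest
      have h₅ := eval_mono p (m := size (a, s)) (n := 2 * Q + 1)
        (by simp; omega)
      rw [code_cons, List.cons_append, List.append_assoc]
      refine Prog.Computes.mono (Frag.repeatWhile_next (Prog.stepAux_whileStmt true _)
        (h₁.seq (h₂.seq (h₃.seq h₄))) ih) ?_
      change (2 * size a + 2 * size l + 2 * size s + 3) + (1 + (p.eval (size (a, s)) +
        (2 * size (f (a, s)) + 2 * size l + 2))) + _ + 1 ≤ _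
      rw [List.length_cons, Nat.add_mul, one_mul]
      omega
  -- `Q` bounds the argument and every accumulator, so `2 * Q + 1` bounds the pairs given to `F`.
  -- The first `Prog.pop` removes the root that joins the list to the initial value.
  refine ⟨Prog.pop.seq W, let Q := q + Polynomial.X
    1 + (Polynomial.X * (10 * Q + p.comp (2 * Q + 1) + 10) + 1) + q, fun x => ?_⟩
  obtain ⟨l, s⟩ := x
  simp only [Polynomial.eval_add, Polynomial.eval_mul, Polynomial.eval_X, Polynomial.eval_ofNat,
    Polynomial.eval_comp, Polynomial.eval_one]
  set N := size (l, s) with hN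
  have hN' : N = size l + size s + 1 := size_pair l s
  refine ⟨(hq l s).trans ((eval_mono q (by omega)).trans (Nat.le_add_left _ _)),
    fun rest => ?_⟩
  have h := main (q.eval N + N) l s rest (by omega) fun l₁ l₂ e => by
    refine (hq l₁ s).trans ((eval_mono q (?_ : _ ≤ N)).trans (Nat.le_add_right _ _))
    have := size_append l₁ l₂
    have := size_pos l₂
    rw [← e] at *
    omega
  rw [code_pair, List.cons_append, List.append_assoc]
  refine ((Prog.pop_computes true _).seq h).mono ?_
  have hl : l.length ≤ N := (length_le_size l).trans (by omega)
  have := Nat.mul_le_mul_right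
    (10 * (q.eval N + N) + p.eval (2 * (q.eval N + N) + 1) + 10) hl
  omega

end PolyTime

end


section

variable {α β γ δ : Type} [ToData α] [ToData β] [ToData γ] [ToData δ]

/-! ### Folds with parameters, and the list operations and arithmetic derived from them -/

namespace PolyTime

/-- The step of `foldl` sees only an element and the accumulator, so the parameter `c` is carried
along inside the accumulator. -/
theorem foldlEnv {step : γ × α × β → β} {g : γ → List α} {s : γ → β} (hs : PolyTime step)
    (hg : PolyTime g) (hs₀ : PolyTime s) (q : Polynomial ℕ)
    (hq : ∀ c (l : List α) b, size (l.foldl (fun b a => step (c, a, b)) b) ≤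
      q.eval (size c + size l + size b)) :
    PolyTime fun c => (g c).foldl (fun b a => step (c, a, b)) (s c) := by
  have e : ∀ (c : γ) (l : List α) (b : β),
      l.foldl (fun (x : γ × β) a => (x.1, step (x.1, a, x.2))) (c, b) =
        (c, l.foldl (fun b a => step (c, a, b)) b) := by
    intro c l
    induction l with
    | nil => intro b; rfl
    | cons a l ih => intro b; simp [ih]
  have h₁ : PolyTime fun x : α × γ × β => (x.2.1, step (x.2.1, x.1, x.2.2)) :=
    (fst.comp snd).pair (hs.comp ((fst.comp snd).pair (fst.pair (snd.comp snd))))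
  have h₂ := foldl h₁ (Polynomial.X + q + 1) fun l x => by
    obtain ⟨c, b⟩ := x
    have h := hq c l b
    have h' := eval_mono q (m := size c + size l + size b)
      (n := size l + size (c, b)) (by simp; omega)
    rw [e]
    simp only [size_pair, Polynomial.eval_add, Polynomial.eval_X, Polynomial.eval_one] at h' ⊢
    omega
  exact (snd.comp (h₂.comp (hg.pair (PolyTime.id.pair hs₀)))).of_eq fun c => by rw [e]

/-- If the growth in one step is bounded independently of the accumulator, the total growth is at
most the length of the list times that bound. -/
theorem foldlEnv_of_growth {step : γ × α × β → β} {g : γ → List α} {s : γ → β}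
    (hs : PolyTime step) (hg : PolyTime g) (hs₀ : PolyTime s) (q : Polynomial ℕ)
    (hq : ∀ c a b, size (step (c, a, b)) ≤ size b + q.eval (size c + size a)) :
    PolyTime fun c => (g c).foldl (fun b a => step (c, a, b)) (s c) := by
  refine foldlEnv hs hg hs₀ (Polynomial.X + Polynomial.X * q) fun c l b => ?_
  have key : ∀ (N : ℕ) (l : List α) (b : β), size c + size l ≤ N →
      size (l.foldl (fun b a => step (c, a, b)) b) ≤ size b + l.length * q.eval N := by
    intro N l
    induction l with
    | nil => intro b _; simp
    | cons a l ih =>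
      intro b h
      simp only [size_cons] at h
      have h₁ := ih (step (c, a, b)) (by omega)
      have h₂ := hq c a b
      have h₃ := eval_mono q (m := size c + size a) (n := N) (by omega)
      rw [List.length_cons, Nat.add_mul, one_mul, List.foldl_cons]
      omega
  have h := key (size c + size l + size b) l b (by omega)
  have h' := Nat.mul_le_mul_right (q.eval (size c + size l + size b))
    ((length_le_size l).trans (by omega : _ ≤ size c + size l + size b))
  simp only [Polynomial.eval_add, Polynomial.eval_X, Polynomial.eval_mul]
  omega

theorem and {p q : α → Bool} (hp : PolyTime p) (hq : PolyTime q) :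
    PolyTime fun x => p x && q x :=
  (hp.cond hq (const false)).of_eq fun x => by cases p x <;> rfl

theorem or {p q : α → Bool} (hp : PolyTime p) (hq : PolyTime q) :
    PolyTime fun x => p x || q x :=
  (hp.cond (const true) hq).of_eq fun x => by cases p x <;> rfl

theorem not {p : α → Bool} (hp : PolyTime p) : PolyTime fun x => !p x :=
  (hp.cond (const false) (const true)).of_eq fun x => by cases p x <;> rfl

theorem listAll {g : γ → List α} {p : γ × α → Bool} (hg : PolyTime g) (hp : PolyTime p) :
    PolyTime fun c => (g c).all fun a => p (c, a) := by
  have := foldlEnv_of_growth (step := fun x : γ × α × Bool => x.2.2 && p (x.1, x.2.1))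
    ((snd.comp snd).and (hp.comp (fst.pair (fst.comp snd)))) hg (const true) 3 fun c a b => by
      have := size_bool (b && p (c, a)); simp; omega
  refine this.of_eq fun c => ?_
  have key : ∀ (l : List α) (b : Bool),
      l.foldl (fun b a => b && p (c, a)) b = (b && l.all fun a => p (c, a)) := by
    intro l
    induction l with
    | nil => simp
    | cons a l ih => intro b; simp [ih, Bool.and_assoc]
  simpa using key (g c) true

theorem listAny {g : γ → List α} {p : γ × α → Bool} (hg : PolyTime g) (hp : PolyTime p) :
    PolyTime fun c => (g c).any fun a => p (c, a) :=
  (hg.listAll hp.not).not.of_eq fun c => by simp [List.all_eq_not_any_not]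

theorem reverse {g : γ → List α} (hg : PolyTime g) : PolyTime fun c => (g c).reverse := by
  have := foldlEnv_of_growth (step := fun x : γ × α × List α => x.2.1 :: x.2.2)
    ((fst.comp snd).cons (snd.comp snd)) hg (const []) (Polynomial.X + 1) fun c a b => by
      simp; omega
  exact this.of_eq fun c => by simp

theorem append {f g : γ → List α} (hf : PolyTime f) (hg : PolyTime g) :
    PolyTime fun c => f c ++ g c := by
  have := foldlEnv_of_growth (step := fun x : γ × α × List α => x.2.1 :: x.2.2)
    ((fst.comp snd).cons (snd.comp snd)) hf.reverse hg (Polynomial.X + 1) fun c a b => by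
      simp; omega
  exact this.of_eq fun c => by simp

theorem map {g : γ → List α} {f : γ × α → β} (hg : PolyTime g) (hf : PolyTime f) :
    PolyTime fun c => (g c).map fun a => f (c, a) := by
  obtain ⟨q, hq⟩ := hf.size_le
  have := foldlEnv_of_growth (step := fun x : γ × α × List β => f (x.1, x.2.1) :: x.2.2)
    ((hf.comp (fst.pair (fst.comp snd))).cons (snd.comp snd)) hg (const [])
    (q.comp (Polynomial.X + 1) + 1) fun c a b => by
      have := hq (c, a)
      simp at this ⊢; omega
  refine this.reverse.of_eq fun c => ?_
  have key : ∀ (l : List α) (b : List β), l.foldl (fun b a => f (c, a) :: b) b =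
      (l.map fun a => f (c, a)).reverse ++ b := by
    intro l
    induction l with
    | nil => simp
    | cons a l ih => intro b; simp [ih]
  simp [key]

theorem filter {g : γ → List α} {p : γ × α → Bool} (hg : PolyTime g) (hp : PolyTime p) :
    PolyTime fun c => (g c).filter fun a => p (c, a) := by
  have := foldlEnv_of_growth
    (step := fun x : γ × α × List α => bif p (x.1, x.2.1) then x.2.1 :: x.2.2 else x.2.2)
    ((hp.comp (fst.pair (fst.comp snd))).cond ((fst.comp snd).cons (snd.comp snd))
      (snd.comp snd)) hg (const []) (Polynomial.X + 1) fun c a b => by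
      cases p (c, a) <;> simp; omega
  refine this.reverse.of_eq fun c => ?_
  have key : ∀ (l : List α) (b : List α),
      l.foldl (fun b a => bif p (c, a) then a :: b else b) b =
      (l.filter fun a => p (c, a)).reverse ++ b := by
    intro l
    induction l with
    | nil => simp
    | cons a l ih => intro b; cases h : p (c, a) <;> simp [ih, h]
  simp [key]

theorem flatMap {g : γ → List α} {f : γ × α → List β} (hg : PolyTime g) (hf : PolyTime f) :
    PolyTime fun c => (g c).flatMap fun a => f (c, a) := by
  obtain ⟨q, hq⟩ := hf.size_le
  have := foldlEnv_of_growth (step := fun x : γ × α × List β => x.2.2 ++ f (x.1, x.2.1))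
    ((snd.comp snd).append (hf.comp (fst.pair (fst.comp snd)))) hg (const [])
    (q.comp (Polynomial.X + 1)) fun c a b => by
      have := hq (c, a)
      have := size_append b (f (c, a))
      simp at *; omega
  refine this.of_eq fun c => ?_
  have key : ∀ (l : List α) (b : List β), l.foldl (fun b a => b ++ f (c, a)) b =
      b ++ l.flatMap fun a => f (c, a) := by
    intro l
    induction l with
    | nil => simp
    | cons a l ih => intro b; simp [ih]
  simp [key]

/-! #### Numbers -/

theorem toUnits : PolyTime fun n : ℕ => List.replicate n () :=
  of_code_eq fun n => by
    induction n with
    | zero => rfl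
    | succ n ih => rw [List.replicate_succ, code_cons, ih]; rfl

theorem length : PolyTime (List.length : List α → ℕ) := by
  have h : PolyTime (List.length : List Unit → ℕ) := of_code_eq fun l => by
    induction l with
    | nil => rfl
    | cons a l ih => rw [code_cons, ← ih]; rfl
  have h' : PolyTime fun l : List α => l.map fun _ => () := PolyTime.id.map (const ())
  exact (h.comp h').of_eq fun l => by simp

theorem succ : PolyTime Nat.succ :=
  (length.comp ((const ()).cons toUnits)).of_eq fun n => by simp

theorem pred : PolyTime Nat.pred :=
  (length.comp (tail.comp toUnits)).of_eq fun n => by simp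

theorem sub {f g : γ → ℕ} (hf : PolyTime f) (hg : PolyTime g) :
    PolyTime fun c => f c - g c := by
  have := foldlEnv_of_growth (step := fun x : γ × Unit × ℕ => x.2.2.pred)
    (pred.comp (snd.comp snd)) (toUnits.comp hg) hf 0 fun c a b => by
      simp [size_nat]
  refine this.of_eq fun c => ?_
  have key : ∀ n b : ℕ, (List.replicate n ()).foldl (fun b _ => b.pred) b = b - n := by
    intro n
    induction n with
    | zero => simp
    | succ n ih => intro b; rw [List.replicate_succ, List.foldl_cons, ih]; simp; omega
  exact key _ _

/-- Two numbers are equal iff both truncated differences vanish, and vanishing is emptiness of a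
list of units. -/
theorem natEq {f g : γ → ℕ} (hf : PolyTime f) (hg : PolyTime g) :
    PolyTime fun c => decide (f c = g c) := by
  have h := fun {f g : γ → ℕ} (hf : PolyTime f) (hg : PolyTime g) =>
    isEmpty.comp (toUnits.comp (hf.sub hg))
  refine ((h hf hg).and (h hg hf)).of_eq fun c => ?_
  rw [Bool.eq_iff_iff]
  simp
  omega

/-- The increment is the counter, which is part of the accumulator, so `foldlEnv_of_growth` does not
apply. The counter grows by two in size per round and hence stays below the invariant bound `N`; the
total is quadratic. -/
theorem range {f : γ → ℕ} (hf : PolyTime f) : PolyTime fun c => List.range (f c) := by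
  have := foldlEnv (step := fun x : γ × Unit × ℕ × List ℕ => (x.2.2.1.succ, x.2.2.1 :: x.2.2.2))
    ((succ.comp (fst.comp (snd.comp snd))).pair
      ((fst.comp (snd.comp snd)).cons (snd.comp (snd.comp snd)))) (toUnits.comp hf)
    (const (0, [])) (Polynomial.X + Polynomial.X * (2 * Polynomial.X + 10))
    fun c l b => by
      have key : ∀ (N : ℕ) (l : List Unit) (b : ℕ × List ℕ), size b.1 + 2 * l.length ≤ N →
          size (l.foldl (fun (b : ℕ × List ℕ) _ => (b.1.succ, b.1 :: b.2)) b) ≤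
            size b + l.length * (N + 3) := by
        intro N l
        induction l with
        | nil => intro b _; simp
        | cons a l ih =>
          rintro ⟨i, m⟩ h
          have := ih (i.succ, i :: m) (by simp [size_nat] at h ⊢; omega)
          rw [List.length_cons, Nat.add_mul, one_mul, List.foldl_cons]
          refine this.trans ?_
          simp [size_nat] at h ⊢
          omega
      have h₁ : size b.1 ≤ size b := by obtain ⟨i, m⟩ := b; simp; omega
      have h₂ := length_le_size l
      have h := key (2 * (size c + size l + size b)) l b (by omega)
      have h' := Nat.mul_le_mul_right (2 * (size c + size l + size b) + 3)
        (h₂.trans (by omega : _ ≤ size c + size l + size b))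
      simp only [Polynomial.eval_add, Polynomial.eval_X, Polynomial.eval_mul,
        Polynomial.eval_ofNat]
      refine h.trans (Nat.add_le_add (by omega) (h'.trans ?_))
      gcongr
      omega
  refine (snd.comp this).reverse.of_eq fun c => ?_
  have key : ∀ n : ℕ, (List.replicate n ()).foldl
      (fun (b : ℕ × List ℕ) _ => (b.1.succ, b.1 :: b.2)) (0, []) = (n, (List.range n).reverse) := by
    intro n
    induction n with
    | zero => simp
    | succ n ih => rw [List.replicate_succ', List.foldl_append, ih]; simp [List.range_succ]
  simp [key]

theorem zip {f g : γ → List ℕ} (hf : PolyTime f) (hg : PolyTime g) :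
    PolyTime fun c => (f c).zip (g c) := by
  -- The fold runs over the first list; the accumulator holds what is left of the second list, and
  -- stays unchanged once that is used up. The default `0` is never taken.
  let step : γ × ℕ × List ℕ × List (ℕ × ℕ) → List ℕ × List (ℕ × ℕ) := fun x =>
    bif x.2.2.1.isEmpty then x.2.2 else (x.2.2.1.tail, (x.2.1, x.2.2.1.headD 0) :: x.2.2.2)
  have h : PolyTime step :=
    (isEmpty.comp (fst.comp (snd.comp snd))).cond (snd.comp snd)
      ((tail.comp (fst.comp (snd.comp snd))).pair
        (((fst.comp snd).pair ((headD 0).comp (fst.comp (snd.comp snd)))).cons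
          (snd.comp (snd.comp snd))))
  have := foldlEnv_of_growth h hf (hg.pair (const [])) (Polynomial.X + 10) fun c a b => by
    obtain ⟨_ | ⟨i, l⟩, m⟩ := b <;> simp [step]; omega
  refine (snd.comp this).reverse.of_eq fun c => ?_
  have key : ∀ (l l' : List ℕ) (m : List (ℕ × ℕ)),
      (l.foldl (fun b a => step (c, a, b)) (l', m)).2 = (l.zip l').reverse ++ m := by
    intro l
    induction l with
    | nil => simp
    | cons a l ih =>
      intro l' m
      cases l' with
      | nil =>
        have := ih [] m
        simpa [step] using this
      | cons b l' => simpa [step] using ih l' ((a, b) :: m)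
  simp [key]

end PolyTime

end

end StackProgram

/-! ### Arc-consistency as a computation on lists of numbers -/

namespace ArcConsistency

open StackProgram

/-- A symbol and a list of arguments: a conjunct, an element of a relation, or the header of a
structure. -/
abbrev Item : Type := ℕ × List ℕ

/-- Read a letter, from right to left. The letters `2` and `3` are the tick and the end marker of
unary numbers, all other letters precede their arguments. -/
def parseStep (t : ℕ) (s : List ℕ × List Item) : List ℕ × List Item :=
  bif decide (t = 2) then ((s.1.headD 0).succ :: s.1.tail, s.2)
  else bif decide (t = 3) then (0 :: s.1, s.2)
  else ([], (t, s.1) :: s.2)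

/-- The leading numbers and the items in a string that is given in reverse order. -/
def parse (w : List ℕ) : List ℕ × List Item :=
  w.foldl (fun s t => parseStep t s) ([], [])

/-- Read an item, from right to left. The symbol `4` is the header of a structure. -/
def groupStep (t : Item) (s : List Item × List (ℕ × List Item)) :
    List Item × List (ℕ × List Item) :=
  bif decide (t.1 = 4) then ([], (t.2.headD 0, s.1) :: s.2) else (t :: s.1, s.2)

/-- The structures in a list of items. -/
def group (l : List Item) : List (ℕ × List Item) :=
  (l.reverse.foldl (fun s t => groupStep t s) ([], [])).2

/-- The elements of the relations and of the equality relation (with the symbol `0`). -/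
def allFacts (m : ℕ) (F : List Item) : List Item :=
  F ++ (List.range m).map fun a => (0, [a, a])

/-- The full lists. -/
def fullLists (n m : ℕ) : List (ℕ × ℕ) :=
  (List.range n).flatMap fun x => (List.range m).map fun a => (x, a)

/-- The element `t` of a relation satisfies the conjunct `c` with values in the lists `D`. -/
def fits (D : List (ℕ × ℕ)) (c t : Item) : Bool :=
  decide (c.1 = t.1) && (c.2.zip t.2).all fun p =>
    (D.any fun q => decide (q.1 = p.1) && decide (q.2 = p.2)) &&
      (c.2.zip t.2).all fun q => !decide (q.1 = p.1) || decide (q.2 = p.2)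

/-- All conjuncts that contain the variable `p.1` support its value `p.2`. -/
def keeps (φ F : List Item) (D : List (ℕ × ℕ)) (p : ℕ × ℕ) : Bool :=
  φ.all fun c => (!c.2.any fun y => decide (y = p.1)) || F.any fun t =>
    fits D c t && (c.2.zip t.2).all fun q => !decide (q.1 = p.1) || decide (q.2 = p.2)

/-- One round of the procedure. -/
def acRound (φ F : List Item) (D : List (ℕ × ℕ)) : List (ℕ × ℕ) := D.filter (keeps φ F D)

/-- The final lists. -/
def finalLists (φ F : List Item) (D : List (ℕ × ℕ)) : List (ℕ × ℕ) :=
  D.foldl (fun D' _ => acRound φ F D') D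

/-- The answer of the procedure when the final lists are `D`. -/
def answer (n : ℕ) (φ F : List Item) (D : List (ℕ × ℕ)) : Bool :=
  ((List.range n).all fun x => D.any fun q => decide (q.1 = x)) &&
    φ.all fun c => F.any fun t => fits D c t

/-- The answer of the procedure on the structure of size `m` with the facts `F`. -/
def accepts (n : ℕ) (φ : List Item) (m : ℕ) (F : List Item) : Bool :=
  answer n φ (allFacts m F) (finalLists φ (allFacts m F) (fullLists n m))

/-- The number of variables of an instance, given as a string in reverse order. -/
def numVars (w : List ℕ) : ℕ := (parse w).1.headD 0

/-- Does the procedure accept the instance on one of the structures? Both are given as strings in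
reverse order. -/
def decideOn (structs inst : List ℕ) : Bool :=
  (group (parse structs).2).any fun B => accepts (numVars inst) (parse inst).2 B.1 B.2

/-! #### Running time -/

section

variable {α β : Type} [ToData α] [ToData β]

open PolyTime

theorem polyTime_parse : PolyTime parse := by
  have h₁ : PolyTime fun x : Unit × ℕ × List ℕ × List Item => x.2.1 := fst.comp snd
  have h₂ : PolyTime fun x : Unit × ℕ × List ℕ × List Item => x.2.2.1 := fst.comp (snd.comp snd)
  have h₃ : PolyTime fun x : Unit × ℕ × List ℕ × List Item => x.2.2.2 := snd.comp (snd.comp snd)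
  have h : PolyTime fun x : Unit × ℕ × List ℕ × List Item => parseStep x.2.1 x.2.2 :=
    (h₁.natEq (const 2)).cond (((succ.comp ((headD 0).comp h₂)).cons (tail.comp h₂)).pair h₃) <|
      (h₁.natEq (const 3)).cond (((const 0).cons h₂).pair h₃) <|
        (const []).pair ((h₁.pair h₂).cons h₃)
  have h' : PolyTime fun w : List ℕ => ((), w) := (const ()).pair .id
  have h'' := foldlEnv_of_growth (g := fun x : Unit × List ℕ => x.2)
    (s := fun _ => (([], []) : List ℕ × List Item))
    (step := fun x : (Unit × List ℕ) × ℕ × List ℕ × List Item => parseStep x.2.1 x.2.2)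
    -- A symbol moves the pending numbers into the new item, so a letter adds at most its own size
    -- and a constant.
    (h.comp ((const ()).pair snd)) snd (const _) (Polynomial.X + 10) (by
      rintro c t ⟨_ | ⟨a, l⟩, m⟩ <;> simp only [parseStep] <;> by_cases h2 : t = 2 <;>
        by_cases h3 : t = 3 <;> simp [h2, h3, size_nat] <;> omega)
  exact h''.comp h'

theorem polyTime_group : PolyTime group := by
  have h₁ : PolyTime fun x : List Item × Item × List Item × List (ℕ × List Item) => x.2.1 :=
    fst.comp snd
  have h₂ : PolyTime fun x : List Item × Item × List Item × List (ℕ × List Item) => x.2.2.1 :=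
    fst.comp (snd.comp snd)
  have h₃ : PolyTime fun x : List Item × Item × List Item × List (ℕ × List Item) => x.2.2.2 :=
    snd.comp (snd.comp snd)
  have h : PolyTime fun x : List Item × Item × List Item × List (ℕ × List Item) =>
      groupStep x.2.1 x.2.2 :=
    ((fst.comp h₁).natEq (const 4)).cond
      ((const []).pair ((((headD 0).comp (snd.comp h₁)).pair h₂).cons h₃)) ((h₁.cons h₂).pair h₃)
  have h'' := foldlEnv_of_growth (g := fun x : List Item => x.reverse)
    (s := fun _ => (([], []) : List Item × List (ℕ × List Item)))
    h (reverse .id) (const _) (Polynomial.X + 10) (by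
      rintro c ⟨t, _ | ⟨a, l⟩⟩ ⟨m, m'⟩ <;> simp only [groupStep] <;> by_cases h4 : t = 4 <;>
        simp [h4, size_nat] <;> omega)
  exact snd.comp h''

theorem polyTime_allFacts {m : α → ℕ} {F : α → List Item} (hm : PolyTime m) (hF : PolyTime F) :
    PolyTime fun x => allFacts (m x) (F x) :=
  hF.append ((range hm).map (f := fun y : α × ℕ => (0, [y.2, y.2]))
    ((const 0).pair (snd.cons (snd.cons (const [])))))

theorem polyTime_fullLists {n m : α → ℕ} (hn : PolyTime n) (hm : PolyTime m) :
    PolyTime fun x => fullLists (n x) (m x) :=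
  (range hn).flatMap (f := fun y : α × ℕ => (List.range (m y.1)).map fun a => (y.2, a))
    ((range (hm.comp fst)).map (f := fun z : (α × ℕ) × ℕ => (z.1.2, z.2)) ((snd.comp fst).pair snd))

theorem polyTime_pairEq {p q : α → ℕ × ℕ} (hp : PolyTime p) (hq : PolyTime q) :
    PolyTime fun x => decide ((p x).1 = (q x).1) && decide ((p x).2 = (q x).2) :=
  ((fst.comp hp).natEq (fst.comp hq)).and ((snd.comp hp).natEq (snd.comp hq))

theorem polyTime_pairImp {p q : α → ℕ × ℕ} (hp : PolyTime p) (hq : PolyTime q) :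
    PolyTime fun x => !decide ((p x).1 = (q x).1) || decide ((p x).2 = (q x).2) :=
  ((fst.comp hp).natEq (fst.comp hq)).not.or ((snd.comp hp).natEq (snd.comp hq))

theorem polyTime_fits {D : α → List (ℕ × ℕ)} {c t : α → Item} (hD : PolyTime D) (hc : PolyTime c)
    (ht : PolyTime t) : PolyTime fun x => fits (D x) (c x) (t x) := by
  have hz : PolyTime fun x => (c x).2.zip (t x).2 := (snd.comp hc).zip (snd.comp ht)
  have h₁ := (hD.comp (fst (α := α) (β := ℕ × ℕ))).listAny
    (p := fun z : (α × ℕ × ℕ) × ℕ × ℕ => decide (z.2.1 = z.1.2.1) && decide (z.2.2 = z.1.2.2))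
    (polyTime_pairEq snd (snd.comp fst))
  have h₂ := (hz.comp (fst (α := α) (β := ℕ × ℕ))).listAll
    (p := fun z : (α × ℕ × ℕ) × ℕ × ℕ => !decide (z.2.1 = z.1.2.1) || decide (z.2.2 = z.1.2.2))
    (polyTime_pairImp snd (snd.comp fst))
  exact ((fst.comp hc).natEq (fst.comp ht)).and (hz.listAll (h₁.and h₂))

theorem polyTime_keeps {φ F : α → List Item} {D : α → List (ℕ × ℕ)} {p : α → ℕ × ℕ}
    (hφ : PolyTime φ) (hF : PolyTime F) (hD : PolyTime D) (hp : PolyTime p) :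
    PolyTime fun x => keeps (φ x) (F x) (D x) (p x) := by
  have hc : PolyTime fun y : α × Item => y.2 := snd
  have h₁ := (snd.comp hc).listAny (p := fun z : (α × Item) × ℕ => decide (z.2 = (p z.1.1).1))
    (snd.natEq (fst.comp (hp.comp (fst.comp fst))))
  have hc' : PolyTime fun z : (α × Item) × Item => z.1.2 := snd.comp fst
  have hp' : PolyTime fun z : (α × Item) × Item => p z.1.1 := hp.comp (fst.comp fst)
  have hD' : PolyTime fun z : (α × Item) × Item => D z.1.1 := hD.comp (fst.comp fst)
  have h₂ := ((snd.comp hc').zip (snd.comp snd)).listAll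
    (p := fun u : ((α × Item) × Item) × ℕ × ℕ =>
      !decide (u.2.1 = (p u.1.1.1).1) || decide (u.2.2 = (p u.1.1.1).2))
    (polyTime_pairImp snd (hp'.comp fst))
  exact hφ.listAll (h₁.not.or ((hF.comp fst).listAny ((polyTime_fits hD' hc' snd).and h₂)))

/-- A round only filters the list, so the accumulator never grows and the growth bound is `0`. -/
theorem polyTime_finalLists {φ F : α → List Item} {D : α → List (ℕ × ℕ)}
    (hφ : PolyTime φ) (hF : PolyTime F) (hD : PolyTime D) :
    PolyTime fun x => finalLists (φ x) (F x) (D x) := by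
  have hφ' : PolyTime fun z : (α × (ℕ × ℕ) × List (ℕ × ℕ)) × ℕ × ℕ => φ z.1.1 :=
    hφ.comp (fst.comp fst)
  have hF' : PolyTime fun z : (α × (ℕ × ℕ) × List (ℕ × ℕ)) × ℕ × ℕ => F z.1.1 :=
    hF.comp (fst.comp fst)
  have hD' : PolyTime fun z : (α × (ℕ × ℕ) × List (ℕ × ℕ)) × ℕ × ℕ => z.1.2.2 :=
    snd.comp (snd.comp fst)
  have h : PolyTime fun y : α × (ℕ × ℕ) × List (ℕ × ℕ) => y.2.2 := snd.comp snd
  exact foldlEnv_of_growth (h.filter (polyTime_keeps hφ' hF' hD' snd)) hD hD 0 fun c a b =>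
    (size_filter_le _ b).trans (Nat.le_add_right _ _)

theorem polyTime_answer {n : α → ℕ} {φ F : α → List Item} {D : α → List (ℕ × ℕ)} (hn : PolyTime n)
    (hφ : PolyTime φ) (hF : PolyTime F) (hD : PolyTime D) :
    PolyTime fun x => answer (n x) (φ x) (F x) (D x) := by
  have h₁ : PolyTime fun z : (α × ℕ) × ℕ × ℕ => z.2.1 := fst.comp snd
  have h₂ : PolyTime fun z : (α × ℕ) × ℕ × ℕ => z.1.2 := snd.comp fst
  have hD' : PolyTime fun z : (α × Item) × Item => D z.1.1 := hD.comp (fst.comp fst)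
  have hc : PolyTime fun z : (α × Item) × Item => z.1.2 := snd.comp fst
  exact ((range hn).listAll ((hD.comp fst).listAny (h₁.natEq h₂))).and
    (hφ.listAll ((hF.comp fst).listAny (polyTime_fits hD' hc snd)))

theorem polyTime_accepts {n m : α → ℕ} {φ F : α → List Item} (hn : PolyTime n)
    (hφ : PolyTime φ) (hm : PolyTime m) (hF : PolyTime F) :
    PolyTime fun x => accepts (n x) (φ x) (m x) (F x) :=
  polyTime_answer hn hφ (polyTime_allFacts hm hF)
    (polyTime_finalLists hφ (polyTime_allFacts hm hF) (polyTime_fullLists hn hm))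

theorem polyTime_numVars : PolyTime numVars := (headD 0).comp (fst.comp polyTime_parse)

theorem polyTime_decideOn : PolyTime fun x : List ℕ × List ℕ => decideOn x.1 x.2 := by
  have h₁ : PolyTime fun y : (List ℕ × List ℕ) × ℕ × List Item => y.1.2 := snd.comp fst
  have h₂ : PolyTime fun y : (List ℕ × List ℕ) × ℕ × List Item => y.2.1 := fst.comp snd
  have h₃ : PolyTime fun y : (List ℕ × List ℕ) × ℕ × List Item => y.2.2 := snd.comp snd
  exact (polyTime_group.comp (snd.comp (polyTime_parse.comp fst))).listAny
    (polyTime_accepts (polyTime_numVars.comp h₁) (snd.comp (polyTime_parse.comp h₁)) h₂ h₃)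

end

end ArcConsistency

/-! ### Correctness of the computation -/

set_option linter.unusedSectionVars false

namespace ArcConsistency

open SamplingCSP

section

variable {L : FirstOrder.Language.{0, 0}} [Finite (Σ k : ℕ, L.Relations k)]

/-- Numbers for the letters. -/
noncomputable def letterNum : Letter L → ℕ
  | .sym R => 5 + (Finite.equivFin (Σ k : ℕ, L.Relations k) R : ℕ)
  | .eq => 0
  | .bot => 1
  | .tick => 2
  | .sep => 3
  | .struct => 4

theorem letterNum_sym_inj {R R' : Σ k : ℕ, L.Relations k} :
    letterNum (.sym R) = letterNum (.sym R') ↔ R = R' := by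
  simp [letterNum, Fin.val_inj]

/-- The arguments of an atomic formula. -/
def args {n : ℕ} : Atom L (Fin n) → List (Fin n)
  | .rel _ x => List.ofFn x
  | .eq x y => [x, y]
  | .bot => []

/-- The symbol of an atomic formula. -/
noncomputable def symbol {n : ℕ} : Atom L (Fin n) → ℕ
  | .rel R _ => letterNum (.sym ⟨_, R⟩)
  | .eq _ _ => 0
  | .bot => 1

/-- An atomic formula, as an item. -/
noncomputable def atomItem {n : ℕ} (a : Atom L (Fin n)) : Item :=
  (symbol a, (args a).map Fin.val)

/-- An element of a relation, as an item. -/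
noncomputable def factItem {m : ℕ} (f : Σ k : ℕ, L.Relations k × (Fin k → Fin m)) : Item :=
  (letterNum (.sym ⟨f.1, f.2.1⟩), (List.ofFn f.2.2).map Fin.val)

theorem mem_args {n : ℕ} {a : Atom L (Fin n)} {y : Fin n} : y ∈ args a ↔ y ∈ a.vars := by
  cases a <;> simp [args, Atom.vars, List.mem_ofFn]

/-! #### Parsing -/

/-- The result of parsing a string. -/
noncomputable def parsed (w : List (Letter L)) : List ℕ × List Item :=
  (w.map letterNum).foldr parseStep ([], [])

/-- Popping a stack into a list reverses the string, so the left fold of the program is a right fold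
over the original string. -/
theorem parse_reverse (w : List (Letter L)) : parse (w.map letterNum).reverse = parsed w := by
  simp [parse, parsed]

/-- From right to left, the end marker opens a new number `0` and each tick increments it; the
default value in `parseStep` plays no role here. -/
theorem parsed_encodeNum (i : ℕ) (w : List (Letter L)) :
    parsed (encodeNum i ++ w) = (i :: (parsed w).1, (parsed w).2) := by
  induction i with
  | zero => simp [parsed, encodeNum, parseStep, letterNum]
  | succ i ih =>
    have : parsed (encodeNum (i + 1) ++ w) = parseStep 2 (parsed (encodeNum i ++ w)) := by
      simp [parsed, encodeNum, List.replicate_succ, letterNum]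
    simp [this, ih, parseStep]

theorem parsed_encodeNums (l : List ℕ) (w : List (Letter L)) :
    parsed (l.flatMap encodeNum ++ w) = (l ++ (parsed w).1, (parsed w).2) := by
  induction l with
  | nil => rfl
  | cons a l ih => simp [List.append_assoc, parsed_encodeNum, ih]

theorem encodeRel_eq {n k : ℕ} (R : L.Relations k) (x : Fin k → Fin n) :
    encodeRel R x = .sym ⟨k, R⟩ :: ((List.ofFn x).map Fin.val).flatMap encodeNum := by
  rw [List.flatMap_map]
  simp [encodeRel, List.flatMap_assoc]

theorem parsed_sym (R : Σ k : ℕ, L.Relations k) (w : List (Letter L)) :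
    parsed (.sym R :: w) = ([], (letterNum (.sym R), (parsed w).1) :: (parsed w).2) := by
  have h₂ : letterNum (.sym R) ≠ 2 := by simp only [letterNum]; omega
  have h₃ : letterNum (.sym R) ≠ 3 := by simp only [letterNum]; omega
  simp [parsed, parseStep, h₂, h₃]

/-- A symbol takes all pending numbers as its arguments; `hw` ensures that none are left over from
the string to its right. -/
theorem parsed_encodeAtom {n : ℕ} (a : Atom L (Fin n)) (w : List (Letter L))
    (hw : (parsed w).1 = []) :
    parsed (encodeAtom a ++ w) = ([], atomItem a :: (parsed w).2) := by
  cases a with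
  | rel R x =>
    simp only [encodeAtom, encodeRel_eq, List.cons_append, parsed_sym, parsed_encodeNums, hw, atomItem, args,
      symbol, List.append_nil]
  | eq x y =>
    have : parsed (encodeAtom (.eq x y) ++ w) =
        parseStep 0 (parsed (encodeNum (x : ℕ) ++ (encodeNum (y : ℕ) ++ w))) := by
      simp [parsed, encodeAtom, letterNum]
    simp [this, parsed_encodeNum, parseStep, hw, atomItem, args, symbol]
  | bot =>
    have : parsed (encodeAtom (.bot : Atom L (Fin n)) ++ w) = parseStep 1 (parsed w) := by
      simp [parsed, encodeAtom, letterNum]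
    simp [this, parseStep, hw, atomItem, args, symbol]

theorem parsed_encodeInstance (φ : Instance L) :
    parsed (encodeInstance φ) = ([φ.1], φ.2.map atomItem) := by
  have : parsed (φ.2.flatMap encodeAtom) = ([], φ.2.map atomItem) := by
    induction φ.2 with
    | nil => rfl
    | cons a l ih => rw [List.flatMap_cons, parsed_encodeAtom _ _ (by rw [ih]), ih]; rfl
  rw [encodeInstance, parsed_encodeNum, this]

theorem parsed_encodeStr (c : StrCode L) (w : List (Letter L)) (hw : (parsed w).1 = []) :
    parsed (encodeStr c ++ w) = ([], (4, [c.size]) :: (c.facts.map factItem ++ (parsed w).2)) := by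
  have h : ∀ l : List (Σ k : ℕ, L.Relations k × (Fin k → Fin c.size)),
      parsed (l.flatMap (fun f => encodeRel f.2.1 f.2.2) ++ w) =
        ([], l.map factItem ++ (parsed w).2) := by
    intro l
    induction l with
    | nil => exact Prod.ext hw rfl
    | cons f l ih =>
      rw [List.flatMap_cons, List.append_assoc, encodeRel_eq, List.cons_append, parsed_sym,
        parsed_encodeNums, ih]
      simp [factItem]
  have h' : parsed (encodeStr c ++ w) = parseStep 4 (parsed (encodeNum c.size ++
      (c.facts.flatMap (fun f => encodeRel f.2.1 f.2.2) ++ w))) := by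
    simp [parsed, encodeStr, letterNum]
  simp [h', parsed_encodeNum, h, parseStep]

theorem parsed_encodeStrList (l : List (StrCode L)) :
    parsed (encodeStrList l) =
      ([], l.flatMap fun c => (4, [c.size]) :: c.facts.map factItem) := by
  induction l with
  | nil => rfl
  | cons c l ih =>
    rw [encodeStrList, List.flatMap_cons, parsed_encodeStr, ← encodeStrList, ih]
    · rfl
    · rw [← encodeStrList, ih]

theorem group_items (l : List (StrCode L)) :
    group (l.flatMap fun c => (4, [c.size]) :: c.facts.map factItem) =
      l.map fun c => (c.size, c.facts.map factItem) := by
  have key : (l.flatMap fun c => ((4, [c.size]) : Item) :: c.facts.map factItem).foldr groupStep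
      ([], []) = ([], l.map fun c => (c.size, c.facts.map factItem)) := by
    induction l with
    | nil => rfl
    | cons c l ih =>
      have h : ∀ (fs : List (Σ k : ℕ, L.Relations k × (Fin k → Fin c.size)))
          (m : List (ℕ × List Item)), (fs.map factItem).foldr groupStep ([], m) =
            (fs.map factItem, m) := by
        intro fs m
        induction fs with
        | nil => rfl
        | cons f fs ih =>
          have : (factItem f).1 ≠ 4 := by simp only [factItem, letterNum]; omega
          simp [ih, groupStep, this]
      rw [List.flatMap_cons, List.foldr_append, ih, List.foldr_cons, h]
      simp [groupStep]
  simp [group, key]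

/-! #### Supporting assignments -/

variable [L.IsRelational]

/-- The facts of a structure, including those on equality. -/
noncomputable def factsOf (c : StrCode L) : List Item := allFacts c.size (c.facts.map factItem)

/-- Equality is treated as a relation with symbol `0` whose elements are the diagonal pairs; no fact
has the symbol `1` of `⊥`. -/
theorem mem_factsOf_iff_holds (c : StrCode L) {n : ℕ} (a : Atom L (Fin n)) (s : Fin n → Fin c.size) :
    (symbol a, (args a).map fun y => (s y : ℕ)) ∈ factsOf c ↔
      Atom.Holds (M := c.toFinStr.Dom) s a := by
  cases a with
  | @rel k R x =>
    have h₀ : letterNum (.sym (⟨k, R⟩ : Σ k : ℕ, L.Relations k)) ≠ 0 := by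
      simp only [letterNum]; omega
    change _ ↔ (⟨k, R, fun i => s (x i)⟩ : Σ k : ℕ, L.Relations k × (Fin k → Fin c.size)) ∈ c.facts
    simp only [factsOf, allFacts, symbol, args, List.mem_append, List.mem_map, factItem,
      Prod.mk.injEq, letterNum_sym_inj]
    constructor
    · rintro (⟨⟨k', R', t⟩, h, h₁, h₂⟩ | ⟨b, -, h₁, -⟩)
      · simp only [Sigma.mk.injEq] at h₁
        obtain ⟨rfl, h₁⟩ := h₁
        obtain rfl := eq_of_heq h₁
        convert h
        rename_i i
        simp only [List.map_ofFn] at h₂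
        exact Fin.ext (congrFun (List.ofFn_injective h₂) i).symm
      · exact absurd h₁.symm h₀
    · intro h
      exact .inl ⟨_, h, rfl, by simp only [List.map_ofFn]; rfl⟩
  | eq x y =>
    change _ ↔ s x = s y
    simp only [factsOf, allFacts, symbol, args, List.mem_append, List.mem_map, factItem,
      Prod.mk.injEq, List.map_cons, List.map_nil, List.mem_range, List.cons.injEq, and_true,
      true_and]
    constructor
    · rintro (⟨f, -, h, -⟩ | ⟨b, -, h₁, h₂⟩)
      · simp [letterNum] at h
      · exact Fin.ext (h₁.symm.trans h₂)
    · intro h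
      exact .inr ⟨s x, (s x).2, rfl, by rw [h]⟩
  | bot =>
    change _ ↔ False
    simp only [factsOf, allFacts, symbol, args, List.mem_append, List.mem_map, factItem,
      Prod.mk.injEq, iff_false]
    rintro (⟨f, -, h, -⟩ | ⟨b, -, h, -⟩)
    · simp only [letterNum] at h; omega
    · omega

/-- The symbol determines the arity. This is needed because `zip` in `fits` would silently cut off
the longer list. -/
theorem length_of_mem_factsOf {c : StrCode L} {n : ℕ} {a : Atom L (Fin n)} {t : Item}
    (ht : t ∈ factsOf c) (h : symbol a = t.1) :
    t.2.length = (args a).length ∧ ∀ v ∈ t.2, v < c.size := by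
  simp only [factsOf, allFacts, List.mem_append, List.mem_map, List.mem_range] at ht
  rcases ht with ⟨⟨k, R, x⟩, -, rfl⟩ | ⟨b, hb, rfl⟩
  · refine ⟨?_, by simp [factItem, List.mem_ofFn]⟩
    cases a with
    | @rel k' R' x' =>
      have := (letterNum_sym_inj.1 h)
      simp only [Sigma.mk.injEq] at this
      simp [factItem, args, this.1]
    | eq x y => simp only [symbol, factItem, letterNum] at h; omega
    | bot => simp only [symbol, factItem, letterNum] at h; omega
  · refine ⟨?_, by simpa using hb⟩
    cases a with
    | @rel k' R' x' => simp [symbol, letterNum] at h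
    | eq x y => simp [args]
    | bot => simp [symbol] at h

/-- The pairs in the zip define a function on the variables that occur, by the consistency
hypothesis `h`; `s₀` provides values for all other variables. -/
theorem exists_assignment {n m : ℕ} (s₀ : Fin n → Fin m) (xs : List (Fin n)) (vs : List ℕ)
    (hl : vs.length = xs.length) (hv : ∀ v ∈ vs, v < m)
    (h : ∀ p ∈ (xs.map Fin.val).zip vs, ∀ q ∈ (xs.map Fin.val).zip vs,
      q.1 = p.1 → q.2 = p.2) :
    ∃ s : Fin n → Fin m, vs = xs.map fun y => (s y : ℕ) := by
  classical
  refine ⟨fun y => if hy : ∃ v : Fin m, ((y : ℕ), (v : ℕ)) ∈ (xs.map Fin.val).zip vs then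
    hy.choose else s₀ y, List.ext_getElem (by simpa using hl) fun i h₁ h₂ => ?_⟩
  have hi : i < xs.length := hl ▸ h₁
  have hmem : ((xs[i] : ℕ), vs[i]) ∈ (xs.map Fin.val).zip vs := by
    rw [List.mem_iff_getElem]
    exact ⟨i, by simp; omega, by simp⟩
  have hy : ∃ v : Fin m, ((xs[i] : ℕ), (v : ℕ)) ∈ (xs.map Fin.val).zip vs :=
    ⟨⟨vs[i], hv _ (List.getElem_mem _)⟩, hmem⟩
  simp only [List.getElem_map]
  rw [dif_pos hy]
  exact h _ hy.choose_spec _ hmem rfl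

/-- The list `D` of pairs represents the lists `E` of the variables. -/
def Represents {n m : ℕ} (D : List (ℕ × ℕ)) (E : Fin n → Set (Fin m)) : Prop :=
  ∀ p : ℕ × ℕ, p ∈ D ↔ ∃ (x : Fin n) (a : Fin m), a ∈ E x ∧ p = (↑x, ↑a)

theorem Represents.mem_iff {n m : ℕ} {D : List (ℕ × ℕ)} {E : Fin n → Set (Fin m)}
    (h : Represents D E) (x : Fin n) (a : Fin m) : ((x : ℕ), (a : ℕ)) ∈ D ↔ a ∈ E x := by
  rw [h]
  constructor
  · rintro ⟨y, b, hb, e⟩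
    simp only [Prod.mk.injEq, Fin.val_inj] at e
    rwa [e.1, e.2]
  · exact fun ha => ⟨x, a, ha, rfl⟩

/-- Fitting facts are the restrictions of supporting assignments to the variables of the conjunct.
The predicate `P` adds a condition on single values: a round uses it to prescribe the value of one
variable, the final check takes it to be trivial. -/
theorem any_fits_iff {c : StrCode L} {n : ℕ} (s₀ : Fin n → Fin c.size) {D : List (ℕ × ℕ)}
    {E : Fin n → Set (Fin c.size)} (hD : Represents D E) (a : Atom L (Fin n))
    (P : ℕ × ℕ → Bool) :
    ((factsOf c).any fun t => fits D (atomItem a) t && ((atomItem a).2.zip t.2).all P) = true ↔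
      ∃ s : Fin n → c.toFinStr.Dom, Supports (M := c.toFinStr.Dom) E a s ∧ ∀ y ∈ a.vars, P (↑y, ↑(s y)) = true := by
  have hzip : ∀ s : Fin n → Fin c.size, ((args a).map Fin.val).zip
      ((args a).map fun y => (s y : ℕ)) = (args a).map fun y : Fin n => ((y : ℕ), (s y : ℕ)) := fun s => by
    rw [List.zip_map']
  have hmem : ∀ p : ℕ × ℕ, (D.any fun q => decide (q.1 = p.1) && decide (q.2 = p.2)) = true ↔
      p ∈ D := fun p => by
    simp only [List.any_eq_true, Bool.and_eq_true, decide_eq_true_eq]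
    exact ⟨fun ⟨q, hq, h₁, h₂⟩ => (Prod.ext h₁ h₂ : q = p) ▸ hq, fun h => ⟨p, h, rfl, rfl⟩⟩
  simp only [List.any_eq_true (p := fun t : Item => _), fits, Bool.and_eq_true, List.all_eq_true, hmem, atomItem,
    decide_eq_true_eq, Bool.or_eq_true, Bool.not_eq_true', decide_eq_false_iff_not,
    ← imp_iff_not_or]
  constructor
  · rintro ⟨⟨t, vs⟩, ht, ⟨h₁, h₂⟩, h₃⟩
    replace h₁ := of_decide_eq_true h₁
    obtain ⟨hl, hv⟩ := length_of_mem_factsOf ht h₁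
    obtain ⟨s, rfl⟩ := exists_assignment s₀ (args a) vs hl hv fun p hp => (h₂ p hp).2
    dsimp only at h₁ h₂ h₃
    subst h₁
    rw [hzip] at h₂ h₃
    refine ⟨s, ⟨fun y hy => ?_, (mem_factsOf_iff_holds c a s).1 ht⟩, fun y hy => ?_⟩
    · exact (hD.mem_iff y (s y)).1 (h₂ _ (List.mem_map.2 ⟨y, mem_args.2 hy, rfl⟩)).1
    · exact h₃ _ (List.mem_map.2 ⟨y, mem_args.2 hy, rfl⟩)
  · rintro ⟨(s : Fin n → Fin c.size), ⟨h₁, h₂⟩, h₃⟩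
    refine ⟨_, (mem_factsOf_iff_holds c a s).2 h₂, ⟨by simp, ?_⟩, ?_⟩
    · dsimp only
      rw [hzip]
      intro p hp
      obtain ⟨y, hy, rfl⟩ := List.mem_map.1 hp
      refine ⟨(hD.mem_iff y (s y)).2 (h₁ y (mem_args.1 hy)), fun q hq => ?_⟩
      obtain ⟨z, hz, rfl⟩ := List.mem_map.1 hq
      intro e
      rw [Fin.ext e]
    · dsimp only
      rw [hzip]
      intro p hp
      obtain ⟨y, hy, rfl⟩ := List.mem_map.1 hp
      exact h₃ y (mem_args.1 hy)

theorem any_fits_iff' {c : StrCode L} {n : ℕ} (s₀ : Fin n → Fin c.size) {D : List (ℕ × ℕ)}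
    {E : Fin n → Set (Fin c.size)} (hD : Represents D E) (a : Atom L (Fin n)) :
    ((factsOf c).any fun t => fits D (atomItem a) t) = true ↔
      ∃ s : Fin n → c.toFinStr.Dom, Supports (M := c.toFinStr.Dom) E a s := by
  simpa using any_fits_iff s₀ hD a fun _ => true

/-- In the test `keeps`, the predicate of `any_fits_iff` says that `x` is sent to the value under
consideration and is vacuous at other variables. -/
theorem represents_acRound {c : StrCode L} {n : ℕ} (s₀ : Fin n → Fin c.size) {D : List (ℕ × ℕ)}
    {E : Fin n → Set (Fin c.size)} (hD : Represents D E) (φ : Conj L n) :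
    Represents (acRound (φ.map atomItem) (factsOf c) D)
      (acStep φ (M := c.toFinStr.Dom) E : Fin n → Set (Fin c.size)) := by
  intro p
  rw [acRound, List.mem_filter]
  have key : ∀ (x : Fin n) (a : Fin c.size), a ∈ E x →
      (keeps (φ.map atomItem) (factsOf c) D (↑x, ↑a) = true ↔
        a ∈ acStep φ (M := c.toFinStr.Dom) E x) := by
    intro x b hb
    simp only [keeps, List.all_map, List.all_eq_true, Function.comp_apply, Bool.or_eq_true,
      any_fits_iff s₀ hD]
    constructor
    · refine fun h => ⟨hb, fun a ha hx => ?_⟩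
      rcases h a ha with h | ⟨s, h₁, h₂⟩
      · simp [atomItem, mem_args, Fin.val_inj] at h
        exact absurd rfl (h x hx)
      · exact ⟨s, Fin.ext (by simpa using h₂ x hx), h₁⟩
    · rintro ⟨-, h⟩ a ha
      by_cases hx : x ∈ a.vars
      · obtain ⟨s, h₁, h₂⟩ := h a ha hx
        refine .inr ⟨s, h₂, fun y _ => ?_⟩
        by_cases hy : y = x
        · subst hy; subst h₁; simp
        · simp [Fin.val_inj, hy]
      · left
        simp [atomItem, mem_args, Fin.val_inj]
        intro y hy e
        exact hx (e ▸ hy)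
  constructor
  · rintro ⟨h₁, h₂⟩
    obtain ⟨x, a, ha, rfl⟩ := (hD p).1 h₁
    exact ⟨x, a, (key x a ha).1 h₂, rfl⟩
  · rintro ⟨x, a, ha, rfl⟩
    exact ⟨(hD.mem_iff x a).2 ha.1, (key x a ha.1).2 ha⟩

theorem represents_fullLists (n m : ℕ) :
    Represents (fullLists n m) (fun _ => Set.univ : Fin n → Set (Fin m)) := by
  rintro ⟨x, a⟩
  simp only [fullLists, List.mem_flatMap, List.mem_range, List.mem_map, Prod.mk.injEq,
    Set.mem_univ, true_and]
  constructor
  · rintro ⟨x, hx, a, ha, rfl, rfl⟩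
    exact ⟨⟨x, hx⟩, ⟨a, ha⟩, rfl, rfl⟩
  · rintro ⟨x, a, rfl, rfl⟩
    exact ⟨x, x.2, a, a.2, rfl, rfl⟩

theorem Represents.unique {n m : ℕ} {D : List (ℕ × ℕ)} {E E' : Fin n → Set (Fin m)}
    (h : Represents D E) (h' : Represents D E') : E = E' := by
  funext x
  ext a
  rw [← h.mem_iff, h'.mem_iff]

/-! ### Stabilisation of the rounds -/

theorem foldl_const_eq_iterate {α β : Type} (f : β → β) (l : List α) (b : β) :
    l.foldl (fun b _ => f b) b = f^[l.length] b := by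
  induction l generalizing b with
  | nil => rfl
  | cons a l ih => rw [List.foldl_cons, ih]; rfl

/-- After `j` rounds the list is stationary or has lost at least `j` entries. After as many rounds
as there are entries it is therefore stationary or empty, and the empty list is stationary too. -/
theorem acRound_finalLists (φ F : List Item) (D : List (ℕ × ℕ)) :
    acRound φ F (finalLists φ F D) = finalLists φ F D := by
  have key : ∀ j, acRound φ F ((acRound φ F)^[j] D) = (acRound φ F)^[j] D ∨
      ((acRound φ F)^[j] D).length + j ≤ D.length := by
    intro j
    induction j with
    | zero => exact .inr le_rfl
    | succ j ih =>
      rw [Function.iterate_succ_apply']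
      rcases ih with h | h
      · left; rw [h, h]
      · by_cases e : acRound φ F ((acRound φ F)^[j] D) = (acRound φ F)^[j] D
        · left; rw [e, e]
        · right
          have h₁ := List.length_filter_le (keeps φ F ((acRound φ F)^[j] D)) ((acRound φ F)^[j] D)
          have h₂ : (acRound φ F ((acRound φ F)^[j] D)).length ≠ ((acRound φ F)^[j] D).length :=
            fun h => e (List.filter_sublist.eq_of_length h)
          have h₃ : (acRound φ F ((acRound φ F)^[j] D)).length ≤ ((acRound φ F)^[j] D).length := h₁
          omega
  rw [finalLists, foldl_const_eq_iterate (acRound φ F)]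
  rcases key D.length with h | h
  · exact h
  · have : (acRound φ F)^[D.length] D = [] := List.eq_nil_of_length_eq_zero (by omega)
    rw [this]
    rfl

/-- `acLists` is the intersection over all rounds. The lists decrease and are constant from round
`J` on, so the intersection is the list of round `J`. -/
theorem represents_finalLists {c : StrCode L} {n : ℕ} (s₀ : Fin n → Fin c.size) (φ : Conj L n) :
    Represents (finalLists (φ.map atomItem) (factsOf c) (fullLists n c.size))
      (acLists φ c.toFinStr.Dom : Fin n → Set (Fin c.size)) := by
  set R := acRound (φ.map atomItem) (factsOf c) with hR
  set E : ℕ → Fin n → Set (Fin c.size) :=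
    fun j => (acStep φ (M := c.toFinStr.Dom))^[j] fun _ => Set.univ with hE
  have hrep : ∀ j, Represents (R^[j] (fullLists n c.size)) (E j) := by
    intro j
    induction j with
    | zero => exact represents_fullLists n c.size
    | succ j ih =>
      have := represents_acRound s₀ ih φ
      simp only [hE, Function.iterate_succ_apply']
      exact this
  have hfix := acRound_finalLists (φ.map atomItem) (factsOf c) (fullLists n c.size)
  rw [finalLists, foldl_const_eq_iterate R] at hfix ⊢
  set J := (fullLists n c.size).length
  have hanti : Antitone E := antitone_nat_of_succ_le fun j x a ha => by
    simp only [hE, Function.iterate_succ_apply'] at ha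
    exact ha.1
  have hstable : ∀ j, E (J + j) = E J := by
    intro j
    refine (hrep (J + j)).unique ?_
    have : R^[J + j] (fullLists n c.size) = R^[J] (fullLists n c.size) := by
      rw [Nat.add_comm, Function.iterate_add_apply]
      exact Function.iterate_fixed hfix j
    rw [this]
    exact hrep J
  have : E J = acLists φ c.toFinStr.Dom := by
    funext x
    ext a
    refine ⟨fun h j => ?_, fun h => h J⟩
    have h' : a ∈ E (J + j) x := by rw [hstable]; exact h
    exact hanti (Nat.le_add_left j J) x h'
  rw [← this]
  exact hrep J

theorem accepts_iff (c : StrCode L) {n : ℕ} (φ : Conj L n) :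
    accepts n (φ.map atomItem) c.size (c.facts.map factItem) = true ↔
      ACAccepts φ c.toFinStr.Dom := by
  change answer n (φ.map atomItem) (factsOf c)
    (finalLists (φ.map atomItem) (factsOf c) (fullLists n c.size)) = true ↔ _
  by_cases hs : Nonempty (Fin n → Fin c.size)
  · obtain ⟨s₀⟩ := hs
    have h := represents_finalLists s₀ φ
    simp only [answer, List.all_map, Bool.and_eq_true, List.all_eq_true, Function.comp_apply,
      any_fits_iff' s₀ h, List.mem_range]
    refine and_congr ⟨fun h' x => ?_, fun h' x hx => ?_⟩ Iff.rfl
    · have := h' x x.2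
      simp only [List.any_eq_true, decide_eq_true_eq] at this
      obtain ⟨p, hp, e⟩ := this
      obtain ⟨y, a, ha, rfl⟩ := (h p).1 hp
      obtain rfl : y = x := Fin.ext e
      exact ⟨a, ha⟩
    · obtain ⟨a, ha⟩ := h' ⟨x, hx⟩
      simp only [List.any_eq_true, decide_eq_true_eq]
      exact ⟨_, (h.mem_iff ⟨x, hx⟩ a).2 ha, rfl⟩
  -- Without any assignment, the structure is empty and there is a variable; its list is empty, so
  -- both sides are false.
  · have hm : c.size = 0 := by
      by_contra h
      exact hs ⟨fun _ => ⟨0, Nat.pos_of_ne_zero h⟩⟩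
    have hn : n ≠ 0 := by
      rintro rfl
      exact hs ⟨Fin.elim0⟩
    have hD : fullLists n c.size = [] := by simp [fullLists, hm]
    constructor
    · intro h
      simp only [hD, finalLists, List.foldl_nil, answer, List.any_nil, Bool.and_eq_true,
        List.all_eq_true, List.mem_range] at h
      exact absurd (h.1 0 (Nat.pos_of_ne_zero hn)) (by simp)
    · intro h
      obtain ⟨a, -⟩ := h.1 ⟨0, Nat.pos_of_ne_zero hn⟩
      have a : Fin c.size := a
      rw [hm] at a
      exact a.elim0

theorem numVars_encodeInstance (φ : Instance L) :
    numVars ((encodeInstance φ).map letterNum).reverse = φ.1 := by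
  simp [numVars, parse_reverse, parsed_encodeInstance]

theorem decideOn_iff (l : List (StrCode L)) (φ : Instance L) :
    decideOn ((encodeStrList l).map letterNum).reverse
      ((encodeInstance φ).map letterNum).reverse = true ↔
      ∃ c ∈ l, ACAccepts φ.2 c.toFinStr.Dom := by
  simp [decideOn, numVars_encodeInstance, parse_reverse, parsed_encodeInstance,
    parsed_encodeStrList, group_items, accepts_iff]

end

end ArcConsistency

/-! ### Arc-consistency and totally symmetric polymorphisms -/

namespace ArcConsistency

open SamplingCSP FirstOrder.Language FirstOrder.Language.Structure

variable {L : FirstOrder.Language.{0, 0}} {n : ℕ} {φ : Conj L n}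

/-- In every round the solution itself is the support of each of its values. -/
theorem mem_acLists_of_solution {M : Type*} [L.Structure M] {s : Fin n → M}
    (hs : ∀ a ∈ φ, a.Holds s) (x : Fin n) : s x ∈ acLists φ M x := by
  intro j
  induction j generalizing x with
  | zero => exact Set.mem_univ _
  | succ j ih =>
    rw [Function.iterate_succ_apply']
    exact ⟨ih x, fun c hc _ => ⟨s, rfl, fun y _ => ih y, hs c hc⟩⟩

theorem acAccepts_of_satIn {M : Type*} [L.Structure M] (h : SatIn φ M) : ACAccepts φ M :=
  let ⟨s, hs⟩ := h
  ⟨fun x => ⟨s x, mem_acLists_of_solution hs x⟩,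
    fun c hc => ⟨s, fun y _ => mem_acLists_of_solution hs y, hs c hc⟩⟩

/-- The final lists are arc-consistent. -/
theorem exists_supports_of_mem_acLists {M : Type*} [L.Structure M] [Finite M] {x : Fin n} {a : M}
    (ha : a ∈ acLists φ M x) {c : Atom L (Fin n)} (hc : c ∈ φ) (hx : x ∈ c.vars) :
    ∃ s : Fin n → M, s x = a ∧ Supports (acLists φ M) c s := by
  have h : ∀ j : ℕ, ∃ s : Fin n → M, s x = a ∧
      Supports ((acStep φ)^[j] fun _ => Set.univ) c s := fun j => by
    have := ha (j + 1)
    rw [Function.iterate_succ_apply'] at this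
    exact this.2 c hc hx
  choose s hs using h
  -- There are finitely many assignments, so one of them is the chosen support in infinitely many
  -- rounds; as the lists shrink, it takes its values in the lists of all rounds.
  obtain ⟨s₀, h₀⟩ := Finite.exists_infinite_fiber s
  have hanti : Antitone fun j => (acStep φ)^[j] fun _ => (Set.univ : Set M) :=
    antitone_nat_of_succ_le fun j y b hb => by
      rw [Function.iterate_succ_apply'] at hb
      exact hb.1
  have h₁ := Set.infinite_coe_iff.1 h₀
  obtain ⟨i, hi⟩ := h₁.nonempty
  obtain rfl : s i = s₀ := hi
  refine ⟨s i, (hs i).1, fun y hy j => ?_, (hs i).2.2⟩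
  obtain ⟨k, hk, hjk⟩ := h₁.exists_gt j
  have hk : s k = s i := hk
  have := (hs k).2.1 y hy
  rw [hk] at this
  exact hanti hjk.le y this

/-- If the image of a homomorphism has totally symmetric polymorphisms, then it satisfies the
conjunctions that are accepted by the procedure. -/
theorem satIn_of_acAccepts [L.IsRelational] {B A : Type*} [L.Structure B] [L.Structure A] [Finite B]
    (h : B →[L] A) (hTS : HasTSPolymorphisms L h.range) (hφ : ACAccepts φ B) : SatIn φ A := by
  classical
  set E := acLists φ B with hE
  let g : B → h.range := fun b => ⟨h b, h.mem_range_self b⟩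
  have := Fintype.ofFinite B
  -- The arity must suffice to enumerate any subset of `B` and any set of assignments; the summand
  -- `1` makes it positive.
  set k := Fintype.card B + Fintype.card (Fin n → B) + 1 with hk
  obtain ⟨f, hf, hsym⟩ := hTS k (by omega)
  -- A left inverse of an embedding of `U` into `Fin k` enumerates `U` with repetitions;
  -- non-emptiness supplies the default value.
  have enum : ∀ {X : Type _} [Fintype X] (U : Set X), U.Nonempty → Fintype.card X ≤ k →
      ∃ e : Fin k → X, Set.range e = U := by
    intro X _ U hU hc
    have : Nonempty U := hU.to_subtype
    have hcard : Fintype.card U ≤ Fintype.card (Fin k) := by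
      rw [Fintype.card_fin]
      exact (Fintype.card_subtype_le _).trans hc
    obtain ⟨i⟩ := Function.Embedding.nonempty_of_card_le hcard
    refine ⟨fun j => (Function.invFun i j : U), ?_⟩
    ext b
    constructor
    · rintro ⟨j, rfl⟩
      exact Subtype.prop _
    · intro hb
      exact ⟨i ⟨b, hb⟩, congrArg Subtype.val (Function.leftInverse_invFun i.injective ⟨b, hb⟩)⟩
  have h₁ : ∀ x, ∃ e : Fin k → B, Set.range e = E x := fun x => enum _ (hφ.1 x) (by omega)
  choose e he using h₁
  refine ⟨fun x => (f fun j => g (e x j) : h.range), fun a ha => ?_⟩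
  obtain ⟨t, ht⟩ := enum {s : Fin n → B | Supports E a s} (hφ.2 a ha) (by omega)
  -- The supports take values in `E x`, and arc-consistency makes every element of `E x` the value
  -- of some support. So both tuples have the same set of entries, and total symmetry applies.
  have hval : ∀ x ∈ a.vars, (f fun j => g (e x j)) = f fun j => g (t j x) := by
    intro x hx
    apply hsym
    have h₂ : Set.range (fun j => t j x) = E x := by
      ext b
      constructor
      · rintro ⟨j, rfl⟩
        have : t j ∈ {s : Fin n → B | Supports E a s} := ht ▸ Set.mem_range_self j
        exact this.1 x hx
      · intro hb
        obtain ⟨s, rfl, hs⟩ := exists_supports_of_mem_acLists hb ha hx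
        obtain ⟨j, rfl⟩ : s ∈ Set.range t := ht.symm ▸ hs
        exact ⟨j, rfl⟩
    change Set.range (g ∘ e x) = Set.range (g ∘ fun j => t j x)
    rw [Set.range_comp, Set.range_comp, he, h₂]
  have hsupp : ∀ j, a.Holds (t j) := fun j => by
    have : t j ∈ {s : Fin n → B | Supports E a s} := ht ▸ Set.mem_range_self j
    exact this.2
  cases a with
  | rel R x =>
    -- The homomorphism maps each supporting tuple into the relation on the image, and the
    -- polymorphism combines these `k` tuples.
    have h₃ := hf _ R (fun j i => g (t j (x i))) fun j => by
      have := h.map_rel R _ (hsupp j)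
      exact this
    have h₄ : (fun i => f fun j => g (t j (x i))) = fun i => f fun j => g (e (x i) j) := by
      funext i
      exact (hval (x i) ⟨i, rfl⟩).symm
    rw [h₄] at h₃
    exact h₃
  | eq x y =>
    refine congrArg Subtype.val (?_ : (f fun j => g (e x j)) = f fun j => g (e y j))
    rw [hval x (.inl rfl), hval y (.inr rfl)]
    congr 1
    funext j
    exact congrArg g (hsupp j)
  -- Since `k` is positive there is a supporting assignment of `⊥`, which is absurd.
  | bot => exact hsupp ⟨0, by omega⟩

/-- The sampling property is used from left to right only; from right to left, the solution is found
in the model `A` that receives the sample. -/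
theorem satModulo_iff_acAccepts [L.IsRelational] {T : L.Theory} {S : ℕ → Set (FinStr L)}
    (hS : IsSampling.{w} T S)
    (hTS : ∀ n : ℕ, ∀ B ∈ S n, ∃ (A : Type w) (_ : L.Structure A), A ⊨ T ∧
      ∃ h : B.Dom →[L] A, HasTSPolymorphisms L h.range) (n : ℕ) (φ : Conj L n) :
    SatModulo.{w} T φ ↔ ∃ B ∈ S n, ACAccepts φ B.Dom := by
  constructor
  · intro h
    obtain ⟨B, hB, h⟩ := ((hS n).2 n le_rfl φ).1 h
    exact ⟨B, hB, acAccepts_of_satIn h⟩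
  · rintro ⟨B, hB, h⟩
    obtain ⟨A, _, hA, f, hf⟩ := hTS n B hB
    exact ⟨A, _, hA, satIn_of_acAccepts f hf h⟩

end ArcConsistency

/-! ### The machine -/

namespace StackProgram

open Turing Turing.TM2 SamplingCSP

/-! ### Bounded runs, iterations of the step function, and the growth of the stacks -/

section Conversion

variable {K : Type} [DecidableEq K] {Γ : K → Type} {σ Λ : Type}

theorem ReachesIn.exists_iterate {m : Λ → Stmt Γ Λ σ} {n : ℕ} {c c' : Cfg Γ Λ σ}
    (h : ReachesIn m n c c') : ∃ k ≤ n, (flip bind (step m))^[k] (some c) = some c' := by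
  induction h with
  | refl n c => exact ⟨0, Nat.zero_le _, rfl⟩
  | head hs _ ih =>
    obtain ⟨k, hk, h⟩ := ih
    refine ⟨k + 1, by omega, ?_⟩
    rw [Function.iterate_succ_apply, ← h, ← hs]
    rfl

theorem reachesIn_of_iterate {m : Λ → Stmt Γ Λ σ} {n : ℕ} {c c' : Cfg Γ Λ σ}
    (h : (flip bind (step m))^[n] (some c) = some c') : ReachesIn m n c c' := by
  induction n generalizing c with
  | zero =>
    obtain rfl : c = c' := Option.some.inj h
    exact .refl _ _
  | succ n ih =>
    rw [Function.iterate_succ_apply] at h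
    have e : flip bind (step m) (some c) = step m c := rfl
    rw [e] at h
    cases hs : step m c with
    | none =>
      -- Without a successor the iteration is stuck at `none`, so it could not have reached `c'`.
      rw [hs, Function.iterate_fixed (by rfl)] at h
      exact absurd h (by simp)
    | some c₁ => exact .head hs (ih (hs ▸ h))

/-- The number of symbols that are pushed by a statement. -/
def pushCount : Stmt Γ Λ σ → ℕ
  | .push _ _ q => pushCount q + 1
  | .peek _ _ q => pushCount q
  | .pop _ _ q => pushCount q
  | .load _ q => pushCount q
  | .branch _ q₁ q₂ => pushCount q₁ + pushCount q₂
  | .goto _ => 0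
  | .halt => 0

theorem length_stepAux_le (q : Stmt Γ Λ σ) (v : σ) (S : ∀ k, List (Γ k)) (k : K) :
    ((stepAux q v S).stk k).length ≤ (S k).length + pushCount q := by
  induction q generalizing v S with
  | push k' f q ih =>
    refine (ih _ _).trans ?_
    by_cases h : k = k'
    · subst h; simp [pushCount]; omega
    · simp [pushCount, Function.update_of_ne h]
  | peek k' f q ih => exact ih _ _
  | pop k' f q ih =>
    refine (ih _ _).trans ?_
    by_cases h : k = k'
    · subst h; simp [pushCount]
    · simp [pushCount, Function.update_of_ne h]
  | load f q ih => exact ih _ _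
  | branch f q₁ q₂ h₁ h₂ =>
    simp only [stepAux, pushCount]
    cases f v
    · exact (h₂ _ _).trans (by omega)
    · exact (h₁ _ _).trans (by omega)
  | goto f => simp [pushCount]
  | halt => simp [pushCount]

/-- The length of what a machine leaves on a stack is bounded by its running time; this controls the
output of the machine for the sampling. -/
theorem ReachesIn.length_le {m : Λ → Stmt Γ Λ σ} {B : ℕ} (hB : ∀ l, pushCount (m l) ≤ B) {n : ℕ}
    {c c' : Cfg Γ Λ σ} (h : ReachesIn m n c c') (k : K) :
    (c'.stk k).length ≤ (c.stk k).length + n * B := by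
  induction h with
  | refl n c => simp
  | @head n c c₁ c₂ hs _ ih =>
    obtain ⟨_ | l, v, S⟩ := c
    · simp at hs
    simp only [step, Option.some.injEq] at hs
    subst hs
    have h₁ := length_stepAux_le (m l) v S k
    have h₂ := hB l
    rw [Nat.add_mul, one_mul]
    dsimp only
    omega

end Conversion

theorem initList_stk (tm : FinTM2) (s : List (tm.Γ tm.k₀)) :
    (initList tm s).stk = Function.update (fun _ => []) tm.k₀ s := by
  funext k
  by_cases h : k = tm.k₀
  · subst h; simp [initList]
  · rw [Function.update_of_ne h]; simp [initList, h]

theorem haltList_stk (tm : FinTM2) (s : List (tm.Γ tm.k₁)) :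
    (haltList tm s).stk = Function.update (fun _ => []) tm.k₁ s := by
  funext k
  by_cases h : k = tm.k₁
  · subst h; simp [haltList]
  · rw [Function.update_of_ne h]; simp [haltList, h]

theorem unaryEncodeNat_eq_replicate (n : ℕ) :
    Computability.unaryEncodeNat n = List.replicate n true := by
  induction n with
  | zero => rfl
  | succ n ih => rw [List.replicate_succ, ← ih]; rfl

instance {L : FirstOrder.Language.{0, 0}} [Finite (Σ k : ℕ, L.Relations k)] : Finite (Letter L) := by
  refine Finite.of_surjective (α := (Σ k : ℕ, L.Relations k) ⊕ Fin 5)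
    (Sum.elim .sym ![.eq, .bot, .tick, .sep, .struct]) ?_
  rintro (R | _ | _ | _ | _ | _)
  exacts [⟨.inl R, rfl⟩, ⟨.inr 0, rfl⟩, ⟨.inr 1, rfl⟩, ⟨.inr 2, rfl⟩, ⟨.inr 3, rfl⟩, ⟨.inr 4, rfl⟩]

/-! #### Stacks and memory of the machine -/

section Combined

variable (tm : FinTM2) (A : Type)

/-- The alphabets of the combined machine. -/
abbrev Alphabet : tm.K ⊕ Reg → Type
  | .inl k => tm.Γ k
  | .inr _ => Bool

/-- The memory of the combined machine. -/
abbrev Memory : Type := tm.σ × Option Bool × Option A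

/-- The memory between the stages of the computation. -/
def memory : Memory tm A := (tm.initialState, none, none)

variable {tm A}

/-- The stacks of the combined machine. -/
def join (P : ∀ k, List (tm.Γ k)) (R : Reg → List Bool) : ∀ k, List (Alphabet tm k)
  | .inl k => P k
  | .inr r => R r

theorem update_join_inl (P : ∀ k, List (tm.Γ k)) (R : Reg → List Bool) (k : tm.K)
    (x : List (tm.Γ k)) :
    Function.update (join P R) (.inl k) x = join (Function.update P k x) R := by
  funext i
  rcases i with i | r
  · by_cases h : i = k
    · subst h; simp [join]
    · rw [Function.update_of_ne (by simpa using h)]; simp [join, Function.update_of_ne h]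
  · rw [Function.update_of_ne (by simp)]; rfl

theorem update_join_inr (P : ∀ k, List (tm.Γ k)) (R : Reg → List Bool) (r : Reg) (x : List Bool) :
    Function.update (join P R) (.inr r) x = join P (Function.update R r x) := by
  funext i
  rcases i with k | i
  · rw [Function.update_of_ne (by simp)]; rfl
  · by_cases h : i = r
    · subst h; simp [join]
    · rw [Function.update_of_ne (by simpa using h)]; simp [join, Function.update_of_ne h]

theorem update_regs_main (m m' a b c k : List Bool) :
    Function.update (regs m a b c k) .main m' = regs m' a b c k := by
  funext r; cases r <;> rfl

/-- A program of the tree machine, on the combined machine. -/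
def liftProg (F : Prog) : Frag (Alphabet tm) (Memory tm A) :=
  Frag.lift (K₁ := Reg) .inr
    { get := fun v => v.2.1
      set := fun v x => (v.1, x, v.2.2)
      get_set := fun _ _ => rfl
      set_set := fun _ _ _ => rfl
      set_get := fun _ => rfl } F

theorem liftProg_runs {F : Prog} {R R' : Reg → List Bool} {n : ℕ} (h : F.Runs none R none R' n)
    (P : ∀ k, List (tm.Γ k)) :
    (liftProg F : Frag _ (Memory tm A)).Runs (memory tm A) (join P R) (memory tm A) (join P R') n :=
  Frag.lift_runs (S := join P R) (S' := join P R') Sum.inr_injective _ h (by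
    rintro (k | r) hk
    · rfl
    · exact absurd ⟨r, rfl⟩ hk)

/-- The given machine, as a program. -/
def machine (tm : FinTM2) : Frag tm.Γ tm.σ :=
  { Label := tm.Λ, fintype := tm.ΛFin, entry := tm.main, code := tm.m }

/-- The given machine, as a part of the combined machine. -/
def liftMachine : Frag (Alphabet tm) (Memory tm A) :=
  Frag.lift (K₁ := tm.K) (Γ := Alphabet tm) .inl
    { get := fun v => v.1
      set := fun v x => (x, v.2)
      get_set := fun _ _ => rfl
      set_set := fun _ _ _ => rfl
      set_get := fun _ => rfl } (machine tm)

theorem liftMachine_runs {P P' : ∀ k, List (tm.Γ k)} {n : ℕ}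
    (h : (machine tm).Runs tm.initialState P tm.initialState P' n) (R : Reg → List Bool) :
    (liftMachine : Frag _ (Memory tm A)).Runs (memory tm A) (join P R) (memory tm A) (join P' R)
      n :=
  Frag.lift_runs (S := join P R) (S' := join P' R) Sum.inl_injective _ h (by
    rintro (k | r) hk
    · exact absurd ⟨k, rfl⟩ hk
    · rfl)

/-- Push the word `w` on a stack. -/
def pushes {K : Type} {Γ : K → Type} {Λ σ : Type} (k : K) : List (Γ k) → Stmt Γ Λ σ → Stmt Γ Λ σ
  | [], q => q
  | s :: w, q => pushes k w (.push k (fun _ => s) q)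

theorem stepAux_pushes {K : Type} [DecidableEq K] {Γ : K → Type} {Λ σ : Type} (k : K)
    (w : List (Γ k)) (q : Stmt Γ Λ σ) (v : σ) (S : ∀ k, List (Γ k)) :
    stepAux (pushes k w q) v S = stepAux q v (Function.update S k (w ++ S k)) := by
  induction w generalizing q with
  | nil => simp [pushes]
  | cons s w ih => simp [pushes, ih]

/-- Read the stack `k`, and put the list of the numbers of its letters on the stack of trees. -/
def readStack (k : tm.K) (e : tm.Γ k → A) (num : A → ℕ) [Fintype A] :
    Frag (Alphabet tm) (Memory tm A) where
  Label := Option A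
  entry := none
  code
    | none => .pop (.inl k) (fun v o => (v.1, v.2.1, Option.map e o)) <|
        .branch (fun v => v.2.2.isSome) (.goto fun v => v.2.2) .halt
    | some x => pushes (Γ := Alphabet tm) (.inr .main) (true :: code (num x)) <|
        .load (fun v => (v.1, v.2.1, none)) <| .goto fun _ => none

/-- Each letter takes two steps: one pops it and remembers it in the label, the other puts its
number in front of the list. The list is thus in reverse order, as `parse` expects. -/
theorem readStack_runs [Fintype A] (k : tm.K) (e : tm.Γ k → A) (num : A → ℕ) (w : List (tm.Γ k)) (l : List ℕ)
    (m : List Bool) (P : ∀ k, List (tm.Γ k)) (hw : P k = w) :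
    (readStack k e num).Runs (memory tm A) (join P (regs (code l ++ m) [] [] [] [])) (memory tm A)
      (join (Function.update P k [])
        (regs (code ((w.map fun x => num (e x)).reverse ++ l) ++ m) [] [] [] []))
      (2 * w.length + 1) := by
  induction w generalizing l P with
  | nil =>
    refine .head (n := 0) ?_ (.refl 0 _)
    simp only [readStack, step, stepAux, update_join_inl]
    simp [join, hw, memory]
  | cons x w ih =>
    refine .head (n := 2 * w.length + 1 + 1)
      (c₁ := ⟨some (some (e x)), (tm.initialState, none, some (e x)),
        join (Function.update P k w) (regs (code l ++ m) [] [] [] [])⟩) ?_ (.head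
      (c₁ := ⟨some none, memory tm A, join (Function.update P k w)
        (regs (code (num (e x) :: l) ++ m) [] [] [] [])⟩) ?_ ?_)
    · simp only [readStack, step, stepAux, update_join_inl]
      simp [join, hw, memory]
    · simp only [readStack, step, stepAux_pushes, stepAux, update_join_inr, update_regs_main,
        memory, code_cons]
      simp [join, regs]
    · have := ih (num (e x) :: l) (Function.update P k w) (by simp)
      simp only [Function.update_idem] at this
      rw [List.map_cons, List.reverse_cons, List.append_assoc]
      exact this

/-- Take a number from the stack of trees, and push that many letters `s` on the stack `k`. -/
def feed (k : tm.K) (s : tm.Γ k) : Frag (Alphabet tm) (Memory tm A) :=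
  Frag.loop <| .pop (.inr .main) (fun v o => (v.1, o, v.2.2)) <|
    .branch (fun v => v.2.1 == some true)
      (.pop (.inr .main) (fun v _ => (v.1, none, v.2.2)) <|
        .push (.inl k) (fun _ => s) <| .goto fun _ => ())
      (.load (fun v => (v.1, none, v.2.2)) .halt)

/-- A successor contributes the two symbols `true`, `false` to the code of a number, so each pass
pops two symbols and pushes one letter; the last pass consumes the final leaf. -/
theorem feed_runs (k : tm.K) (s : tm.Γ k) (n : ℕ) (m : List Bool) (P : ∀ k, List (tm.Γ k)) :
    (feed k s : Frag _ (Memory tm A)).Runs (memory tm A)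
      (join P (regs (code n ++ m) [] [] [] [])) (memory tm A)
      (join (Function.update P k (List.replicate n s ++ P k)) (regs m [] [] [] [])) (n + 1) := by
  induction n generalizing P with
  | zero =>
    refine Frag.loop_exit ?_
    simp only [stepAux, update_join_inr, update_regs_main]
    have : code 0 = [false] := rfl
    simp [join, regs, memory, this]
  | succ n ih =>
    have : code (n + 1) = true :: false :: code n := rfl
    have ih := ih (Function.update P k (s :: P k))
    simp only [Function.update_idem, Function.update_self] at ih
    refine Frag.loop_next (v₁ := memory tm A)
      (S₁ := join (Function.update P k (s :: P k)) (regs (code n ++ m) [] [] [] [])) ?_ ?_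
    · simp only [stepAux, update_join_inr, update_regs_main, update_join_inl]
      simp [join, regs, memory, this]
    · rw [List.replicate_succ', List.append_assoc]
      exact ih

end Combined

/-- Take a truth value from the stack of trees, and put it on the stack `a`. -/
def output : Prog :=
  Frag.ite Prog.testStmt
    (Frag.loop <| .pop .main (fun _ _ => none) <| .pop .main (fun _ _ => none) <|
      .push .a (fun _ => true) .halt)
    (Frag.loop <| .push .a (fun _ => false) .halt)

theorem output_runs (b : Bool) :
    output.Runs none (regs (code b) [] [] [] []) none (regs [] [b] [] [] []) 2 := by
  cases b
  · refine Frag.ite_runs_false (Prog.stepAux_testStmt false []) (Frag.loop_exit ?_)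
    simp only [stepAux, Cfg.mk.injEq, true_and]
    funext r; cases r <;> rfl
  · refine Frag.ite_runs_true (Prog.stepAux_testStmt true [false, false]) (Frag.loop_exit ?_)
    simp only [stepAux, Cfg.mk.injEq, true_and]
    funext r; cases r <;> rfl


/-! ### The decision machine for the CSP and its running time -/

open Turing Turing.TM2 SamplingCSP ArcConsistency

theorem size_le_of_forall {l : List ℕ} {C : ℕ} (h : ∀ x ∈ l, size x ≤ C) :
    size l ≤ l.length * (C + 1) + 1 := by
  induction l with
  | nil => simp
  | cons a l ih =>
    have h₁ := h a (List.mem_cons_self ..)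
    have h₂ := ih fun x hx => h x (List.mem_cons_of_mem _ hx)
    rw [size_cons, List.length_cons, Nat.add_mul, one_mul]
    omega

variable {L : FirstOrder.Language.{0, 0}}

/-- The alphabet is finite because the signature is; so a string and its list of letter numbers have
the same size up to a constant factor. -/
theorem exists_size_letterNum_le [Finite (Σ k : ℕ, L.Relations k)] :
    ∃ C, ∀ x : Letter L, size (letterNum x) ≤ C := by
  obtain ⟨C, hC⟩ := (Set.finite_range fun x : Letter L => size (letterNum x)).bddAbove
  exact ⟨C, fun x => hC ⟨x, rfl⟩⟩

theorem cspPolyTime [L.IsRelational] [Finite (Σ k : ℕ, L.Relations k)] {T : L.Theory}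
    {S : ℕ → Set (FinStr L)} (hpoly : PolyTimeComputable S)
    (hac : ∀ (n : ℕ) (φ : Conj L n), SatModulo.{w} T φ ↔ ∃ B ∈ S n, ACAccepts φ B.Dom) :
    CSPPolyTime.{w} T := by
  classical
  obtain ⟨f, hf, ⟨H⟩⟩ := hpoly
  obtain ⟨C, hC⟩ := exists_size_letterNum_le (L := L)
  obtain ⟨G₁, p₁, h₁⟩ := polyTime_numVars.pair (PolyTime.id (α := List ℕ))
  obtain ⟨G₂, p₂, h₂⟩ := polyTime_decideOn
  let _ : Fintype (Letter L) := Fintype.ofFinite _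
  let tm := H.tm
  let _ : Fintype tm.Λ := tm.ΛFin
  let _ : Fintype tm.K := tm.kFin
  let e : tm.Γ tm.k₁ ≃ Letter L := H.outputAlphabet
  let s : tm.Γ tm.k₀ := H.inputAlphabet.symm true
  let B : ℕ := ∑ l : tm.Λ, pushCount (tm.m l)
  let read : Frag (Alphabet tm) (Memory tm (Letter L)) := readStack tm.k₁ e letterNum
  -- The pushed `false` is an empty list onto which the instance is read. `G₁` produces the pair of
  -- `n` and the instance, `Prog.pop` splits it, and `n` is fed to the given machine. Its output is
  -- read onto a second empty list; the pushed `true` pairs it with the instance for `G₂`.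
  let F : Frag (Alphabet tm) (Memory tm (Letter L)) :=
    (liftProg (Prog.push false)).seq <| read.seq <| (liftProg G₁).seq <|
      (liftProg Prog.pop).seq <| (feed tm.k₀ s).seq <| liftMachine.seq <|
      (liftProg (Prog.push false)).seq <| read.seq <| (liftProg (Prog.push true)).seq <|
      (liftProg G₂).seq (liftProg output)
  let M : FinTM2 :=
    { K := tm.K ⊕ Reg
      -- The instance is given on the output stack of the given machine, whose alphabet is already
      -- identified with the letters. It is emptied before that machine starts.
      k₀ := .inl tm.k₁
      k₁ := .inr .a
      Γ := Alphabet tm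
      Λ := F.Label
      main := F.entry
      σ := Memory tm (Letter L)
      initialState := memory tm (Letter L)
      σFin := by
        have := tm.σFin
        exact inferInstanceAs (Fintype (tm.σ × Option Bool × Option (Letter L)))
      Γk₀Fin := Fintype.ofEquiv (Letter L) e.symm
      m := F.code }
  -- `Q` bounds the length of the list of samples as a string: the initial contents of the stack
  -- plus at most `B` symbols per step. `N` turns the length of a string into the size of its list
  -- of letter numbers.
  let Q : Polynomial ℕ := Polynomial.X + H.time * Polynomial.C B
  let N : Polynomial ℕ := Polynomial.X * Polynomial.C (C + 1) + 1
  let time : Polynomial ℕ := 3 * Polynomial.X + 2 * Q + H.time + p₁.comp N +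
    p₂.comp (N.comp Q + N + 1) + 20
  refine ⟨⟨⟨M, e, Equiv.refl Bool⟩, time, fun φ => ?_⟩⟩
  set w := encodeInstance φ with hw
  set u := encodeStrList (f φ.1) with hu
  set w' := (w.map letterNum).reverse with hw'
  set u' := (u.map letterNum).reverse with hu'
  -- The number of variables is written in unary, so time polynomial in it is polynomial in the
  -- input length.
  have hn : φ.1 ≤ w.length := by
    rw [hw]; simp [encodeInstance, encodeNum]
  have hmono := fun (p : Polynomial ℕ) {a b : ℕ} => eval_mono p (m := a) (n := b)
  -- the run of the given machine
  have hlen : (Computability.unaryEncodeNat φ.1).length = φ.1 := by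
    simp [unaryEncodeNat_eq_replicate]
  have run : (machine tm).Runs tm.initialState
      (Function.update (fun _ => []) tm.k₀ (List.replicate φ.1 s)) tm.initialState
      (Function.update (fun _ => []) tm.k₁ (u.map e.symm)) (H.time.eval φ.1) := by
    have ev := H.outputsFun φ.1
    rw [hlen] at ev
    have := (reachesIn_of_iterate (m := tm.m) (n := ev.steps) ev.evals_in_steps).mono ev.steps_le_m
    have i₁ := initList_stk tm (List.map H.inputAlphabet.invFun (Computability.unaryEncodeNat φ.1))
    have i₂ := haltList_stk tm (List.map H.outputAlphabet.invFun (encodeStrList (f φ.1)))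
    rw [unaryEncodeNat_eq_replicate, List.map_replicate] at i₁
    change ReachesIn tm.m _ _ _
    have e₁ : (⟨some tm.main, tm.initialState, Function.update (fun _ => []) tm.k₀
        (List.replicate φ.1 s)⟩ : Cfg tm.Γ tm.Λ tm.σ) =
        initList tm (List.map H.inputAlphabet.invFun (Computability.unaryEncodeNat φ.1)) := by
      rw [unaryEncodeNat_eq_replicate, List.map_replicate]
      exact (congrArg (fun S => (⟨some tm.main, tm.initialState, S⟩ : Cfg tm.Γ tm.Λ tm.σ)) i₁).symm
    have e₂ : (⟨none, tm.initialState, Function.update (fun _ => []) tm.k₁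
        (u.map e.symm)⟩ : Cfg tm.Γ tm.Λ tm.σ) =
        haltList tm (List.map H.outputAlphabet.invFun (encodeStrList (f φ.1))) :=
      (congrArg (fun S => (⟨none, tm.initialState, S⟩ : Cfg tm.Γ tm.Λ tm.σ)) i₂).symm
    exact e₁ ▸ e₂ ▸ this
  -- the length of its output
  have hul : u.length ≤ Q.eval w.length := by
    have hB : ∀ l, pushCount ((machine tm).code l) ≤ B := fun l =>
      Finset.single_le_sum (f := fun l : tm.Λ => pushCount (tm.m l))
        (fun _ _ => Nat.zero_le _) (Finset.mem_univ (l : tm.Λ))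
    have h := ReachesIn.length_le hB run tm.k₁
    have h' : ((Function.update (fun _ => []) tm.k₀ (List.replicate φ.1 s) :
        ∀ k, List (tm.Γ k)) tm.k₁).length ≤ φ.1 := by
      -- The given machine may use the same stack for input and output, so its output stack need not
      -- be empty at the start.
      by_cases hk : tm.k₁ = tm.k₀
      · generalize tm.k₁ = k at hk
        subst hk
        simp
      · rw [Function.update_of_ne hk]; simp
    have h'' := Nat.mul_le_mul_right B (hmono H.time hn)
    simp only [Function.update_self, List.length_map] at h
    simp only [Q, Polynomial.eval_add, Polynomial.eval_X, Polynomial.eval_mul, Polynomial.eval_C]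
    omega
  have hNu : size u' ≤ N.eval (Q.eval w.length) := by
    have := size_le_of_forall (l := u') (C := C) fun x hx => by
      simp only [hu', List.mem_reverse, List.mem_map] at hx
      obtain ⟨x, -, rfl⟩ := hx
      exact hC x
    refine (this.trans_eq ?_).trans (hmono N hul)
    simp [N, hu']
  have hNw : size w' ≤ N.eval w.length := by
    have := size_le_of_forall (l := w') (C := C) fun x hx => by
      simp only [hw', List.mem_reverse, List.mem_map] at hx
      obtain ⟨x, -, rfl⟩ := hx
      exact hC x
    refine this.trans_eq ?_
    simp [N, hw']
  -- the result
  have hres : decideOn u' w' = decide (SatModulo.{w} T φ.2) := by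
    rw [Bool.eq_iff_iff, decideOn_iff, decide_eq_true_eq, hac, hf]
    constructor
    · rintro ⟨c, hc, h⟩
      exact ⟨_, ⟨c, hc, rfl⟩, h⟩
    · rintro ⟨_, ⟨c, hc, rfl⟩, h⟩
      exact ⟨c, hc, h⟩
  -- the run of the combined machine
  have readRun : ∀ (v : List (Letter L)) (m : List Bool),
      read.Runs (memory tm (Letter L)) (join (Function.update (fun _ => []) tm.k₁ (v.map e.symm))
        (regs (code ([] : List ℕ) ++ m) [] [] [] [])) (memory tm (Letter L))
        (join (fun _ => []) (regs (code (v.map letterNum).reverse ++ m) [] [] [] []))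
        (2 * v.length + 1) := by
    intro v m
    have := readStack_runs (tm := tm) (A := Letter L) tm.k₁ e letterNum (v.map e.symm) [] m
      (Function.update (fun _ => []) tm.k₁ (v.map e.symm)) (by simp)
    simpa [Function.comp_def, Function.update_idem] using this
  have feedRun := feed_runs (tm := tm) (A := Letter L) tm.k₀ s φ.1 (code w') fun _ => []
  have hnv : numVars w' = φ.1 := numVars_encodeInstance φ
  have h₁w : G₁.Computes (code w' ++ []) (code (numVars w', w') ++ []) _ := (h₁ w').2 []
  rw [hnv, code_pair] at h₁w
  have h₂w : G₂.Computes (code (u', w') ++ []) (code (decideOn u' w') ++ []) _ :=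
    (h₂ (u', w')).2 []
  rw [hres, code_pair] at h₂w
  simp only [List.append_nil] at feedRun h₁w h₂w
  have total : F.Runs (memory tm (Letter L))
      (join (Function.update (fun _ => []) tm.k₁ (w.map e.symm)) (regs [] [] [] [] []))
      (memory tm (Letter L))
      (join (fun _ => []) (regs [] [decide (SatModulo.{w} T φ.2)] [] [] [])) (time.eval w.length) := by
    refine (Frag.seq_runs (liftProg_runs (Prog.push_computes false []) _) <|
      Frag.seq_runs (readRun w []) <|
      Frag.seq_runs (liftProg_runs (by rw [List.append_nil]; exact h₁w) _) <|
      Frag.seq_runs (liftProg_runs (Prog.pop_computes true _) _) <|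
      Frag.seq_runs feedRun <|
      Frag.seq_runs (liftMachine_runs (by simpa using run) _) <|
      Frag.seq_runs (liftProg_runs (Prog.push_computes false _) _) <|
      Frag.seq_runs (readRun u (code w')) <|
      Frag.seq_runs (liftProg_runs (Prog.push_computes true _) _) <|
      Frag.seq_runs (liftProg_runs h₂w _) (liftProg_runs (output_runs _) _)).mono ?_
    have b₁ := hmono p₁ hNw
    have b₂ := hmono p₂ (a := size (u', w')) (b := N.eval (Q.eval w.length) + N.eval w.length + 1)
      (by rw [size_pair]; omega)
    have b₃ := hmono H.time hn
    simp only [time, Polynomial.eval_add, Polynomial.eval_mul, Polynomial.eval_X,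
      Polynomial.eval_ofNat, Polynomial.eval_comp, Polynomial.eval_one]
    omega
  have hex := ReachesIn.exists_iterate total
  have i₁ := initList_stk M (w.map e.symm)
  have i₂ := haltList_stk M [decide (SatModulo.{w} T φ.2)]
  refine ⟨⟨hex.choose, ?_⟩, hex.choose_spec.1⟩
  have e₁ : initList M (w.map e.symm) = ⟨some F.entry, memory tm (Letter L),
      join (Function.update (fun _ => []) tm.k₁ (w.map e.symm)) (regs [] [] [] [] [])⟩ := by
    rw [← update_join_inl]
    have : join (fun _ => []) (regs [] [] [] [] []) = (fun _ => [] : ∀ k, List (Alphabet tm k)) := by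
      funext k
      rcases k with k | r
      · rfl
      · cases r <;> rfl
    rw [this]
    exact congrArg (fun S => (⟨some F.entry, memory tm (Letter L), S⟩ : Cfg _ _ _)) i₁
  have e₂ : haltList M [decide (SatModulo.{w} T φ.2)] = ⟨none, memory tm (Letter L),
      join (fun _ => []) (regs [] [decide (SatModulo.{w} T φ.2)] [] [] [])⟩ := by
    have : join (fun _ => []) (regs [] [decide (SatModulo.{w} T φ.2)] [] [] []) =
        (Function.update (fun _ => []) (.inr .a) [decide (SatModulo.{w} T φ.2)] :
          ∀ k, List (Alphabet tm k)) := by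
      funext k
      rcases k with k | r
      · rfl
      · cases r <;> rfl
    rw [this]
    exact congrArg (fun S => (⟨none, memory tm (Letter L), S⟩ : Cfg _ _ _)) i₂
  change (flip bind (step F.code))^[hex.choose] (some (initList M (w.map e.symm))) =
    some (haltList M [decide (SatModulo.{w} T φ.2)])
  rw [e₁, e₂]
  exact hex.choose_spec.2

end StackProgram

/-- The machine decides acceptance by arc-consistency on the samples, so the equivalence with
satisfiability comes first and yields its correctness. -/
theorem mainTheorem2 (L : FirstOrder.Language.{0, 0}) [L.IsRelational]
    [Finite (Σ k : ℕ, L.Relations k)] (T : L.Theory) (S : ℕ → Set (SamplingCSP.FinStr L))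
    (hS : SamplingCSP.IsSampling.{w} T S) (hpoly : SamplingCSP.PolyTimeComputable S)
    (hTS : ∀ n : ℕ, ∀ B ∈ S n, ∃ (A : Type w) (_ : L.Structure A), A ⊨ T ∧
      ∃ h : B.Dom →[L] A, SamplingCSP.HasTSPolymorphisms L h.range) :
    SamplingCSP.CSPPolyTime.{w} T ∧
      ∀ (n : ℕ) (φ : SamplingCSP.Conj L n),
        SamplingCSP.SatModulo.{w} T φ ↔ ∃ B ∈ S n, SamplingCSP.ACAccepts φ B.Dom :=
  have h := ArcConsistency.satModulo_iff_acAccepts hS hTS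
  ⟨StackProgram.cspPolyTime hpoly h, h⟩
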